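/- Let $n\ge 1$, let $c>0$ be the speed of light, and let $a:[0,\infty)\to(0,\infty)$ be twice differentiable with $a(0)=1$, satisfying one of the following: - ($H_1$) $\dot a(t)>0$ and $\ddot a(t)\ge 0$ for all $t\ge 0$; - ($H_2$) $\dot a(t)>0$ and $\ddot a(t)<0$ for all $t\ge 0$, and there is $\delta_0\in(0,1)$ with $a(t)\ge(1+t)^{\frac{1+\delta_0}{2}}$ for all $t\ge 0$. Let $\rho_0\in C^1(\mathbb R^n;\mathbb R)$ have bounded $C^1$ norm and $v_0\in C^2(\mathbb R^n;\mathbb R^n)$ have bounded $C^2$ norm. Consider, for $\varepsilon\ge 0$, the Cauchy problem for relativistic dust in the spacetime with metric $-dt^2+a^2(t)\sum_{i=1}^n(dx^i)^2$, with unknowns the density $\rho$ and the velocity $v=(v^1,\dots,v^n)$, and with $u=|v|^2=\sum_i (v^i)^2$: $$ \begin{cases} \partial_t\rho+\sum_{i=1}^{n}\frac{v^i}{a}\partial_{x^i}\rho+\rho\left\{\frac{\dot a}{a}\left(\frac{u}{c^2}+n\right)+\frac{\partial_t u}{c^2-u}+\sum_{i=1}^{n}\left(\frac{1}{a}\partial_{x^i}v^i+\frac{v^i}{a(c^2-u)}\partial_{x^i}u\right)\right\}=0,\\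 \partial_t v^i+\sum_{j=1}^{n}\frac{v^j}{a}\partial_{x^j}v^i+\frac{\dot a}{a}v^i-\frac{\dot a}{a}\frac{|v|^2}{c^2}v^i=0,\qquad i=1,\dots,n,\\ \rho(0,x)=\varepsilon\rho_0(x),\qquad v(0,x)=\varepsilon v_0(x). \end{cases} $$ Then there exist constants $\varepsilon_0>0$ and $C>0$, such that for every $\varepsilon\in[0,\varepsilon_0]$ this Cauchy problem has a global classical solution $(\rho,v)\in C^1([0,\infty)\times\mathbb R^n)$ with $|v|<c$, for which $\rho$ and the spatial gradient $\nabla\rho$ are bounded on $[0,\infty)\times\mathbb R^n$, $$|\rho(t,x)|\le C\,\varepsilon\,a(t)^{-n}\qquad\text{for all }t\ge 0,\ x\in\mathbb R^n,$$ and $\rho(t,x)\to 0$ and $\nabla\rho(t,x)\to 0$ as $t\to\infty$, uniformly in $x\in\mathbb R^n$. -/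

import Mathlib

open Set Filter

noncomputable section

namespace RelDust

/-- Euclidean space `ℝⁿ` with its Euclidean norm. -/
abbrev E (n : ℕ) : Type := EuclideanSpace ℝ (Fin n)

/-- Derivative in time on `[0, ∞)` (one-sided at `t = 0`). -/
def tderiv (f : ℝ → ℝ) (t : ℝ) : ℝ := derivWithin f (Ici 0) t

/-- The scale factor: positive and twice differentiable on `[0, ∞)`, normalised by `a 0 = 1`. -/
structure IsScaleFactor (a : ℝ → ℝ) : Prop where
  diff : DifferentiableOn ℝ a (Ici 0)
  diff_tderiv : DifferentiableOn ℝ (tderiv a) (Ici 0)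
  pos : ∀ t, 0 ≤ t → 0 < a t
  init : a 0 = 1

/-- Expansion with `a' > 0` and `a'' ≥ 0` on `[0, ∞)`. -/
def AssumptionH1 (a : ℝ → ℝ) : Prop :=
  ∀ t, 0 ≤ t → 0 < tderiv a t ∧ 0 ≤ tderiv (tderiv a) t

/-- Decelerated expansion that is at least as fast as `(1 + t) ^ ((1 + δ₀) / 2)`, `0 < δ₀ < 1`. -/
def AssumptionH2 (a : ℝ → ℝ) : Prop :=
  (∀ t, 0 ≤ t → 0 < tderiv a t ∧ tderiv (tderiv a) t < 0) ∧
    ∃ δ₀ : ℝ, 0 < δ₀ ∧ δ₀ < 1 ∧ ∀ t : ℝ, 0 ≤ t → (1 + t) ^ ((1 + δ₀) / 2) ≤ a t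

/-- `f` is of class `C^k` and all its derivatives of order `0, …, k` are bounded. -/
def HasBoundedCkNorm {n : ℕ} {F : Type*} [NormedAddCommGroup F] [NormedSpace ℝ F]
    (k : ℕ) (f : E n → F) : Prop :=
  ContDiff ℝ k f ∧ ∃ K : ℝ, ∀ j : ℕ, j ≤ k → ∀ x : E n, ‖iteratedFDeriv ℝ j f x‖ ≤ K

/-- Partial derivative in time of a scalar field on `[0, ∞) × ℝⁿ`. -/
def pt {n : ℕ} (f : ℝ → E n → ℝ) (t : ℝ) (x : E n) : ℝ := tderiv (fun s => f s x) t

/-- Partial derivative in the direction `xⁱ` of a scalar field on `[0, ∞) × ℝⁿ`. -/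
def px {n : ℕ} (i : Fin n) (f : ℝ → E n → ℝ) (t : ℝ) (x : E n) : ℝ :=
  fderiv ℝ (f t) x (EuclideanSpace.single i 1)

/-- The `i`-th component of a time-dependent vector field. -/
def comp {n : ℕ} (v : ℝ → E n → E n) (i : Fin n) : ℝ → E n → ℝ := fun t x => v t x i

/-- `u = |v|² = ∑ᵢ (vⁱ)²`. -/
def speedSq {n : ℕ} (v : ℝ → E n → E n) : ℝ → E n → ℝ := fun t x => ∑ i, (v t x i) ^ 2

/-- The density equation at the point `(t, x)`. -/
def DensityEq {n : ℕ} (c : ℝ) (a : ℝ → ℝ) (ρ : ℝ → E n → ℝ) (v : ℝ → E n → E n)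
    (t : ℝ) (x : E n) : Prop :=
  pt ρ t x + ∑ i, comp v i t x / a t * px i ρ t x
    + ρ t x * (tderiv a t / a t * (speedSq v t x / c ^ 2 + n)
        + pt (speedSq v) t x / (c ^ 2 - speedSq v t x)
        + ∑ i, (px i (comp v i) t x * (1 / a t)
            + px i (speedSq v) t x * (comp v i t x / (a t * (c ^ 2 - speedSq v t x))))) = 0

/-- The velocity (relativistic Burgers) equations at the point `(t, x)`. -/
def VelocityEq {n : ℕ} (c : ℝ) (a : ℝ → ℝ) (v : ℝ → E n → E n) (t : ℝ) (x : E n) : Prop :=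
  ∀ i, pt (comp v i) t x + ∑ j, comp v j t x / a t * px j (comp v i) t x
    + tderiv a t / a t * comp v i t x
    - tderiv a t / a t * (speedSq v t x / c ^ 2) * comp v i t x = 0

/-- A global classical solution, of class `C¹` on `[0, ∞) × ℝⁿ` and with `|v| < c`, of the
relativistic dust system with initial data `(ε ρ₀, ε v₀)`. -/
structure IsGlobalClassicalSolution {n : ℕ} (c : ℝ) (a : ℝ → ℝ) (ε : ℝ)
    (ρ₀ : E n → ℝ) (v₀ : E n → E n) (ρ : ℝ → E n → ℝ) (v : ℝ → E n → E n) : Prop where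
  contDiff_density : ContDiffOn ℝ 1 (fun p : ℝ × E n => ρ p.1 p.2) (Ici 0 ×ˢ univ)
  contDiff_velocity : ContDiffOn ℝ 1 (fun p : ℝ × E n => v p.1 p.2) (Ici 0 ×ˢ univ)
  subluminal : ∀ t, 0 ≤ t → ∀ x, ‖v t x‖ < c
  density_eq : ∀ t, 0 ≤ t → ∀ x, DensityEq c a ρ v t x
  velocity_eq : ∀ t, 0 ≤ t → ∀ x, VelocityEq c a v t x
  density_init : ∀ x, ρ 0 x = ε * ρ₀ x
  velocity_init : ∀ x, v 0 x = ε • v₀ x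

end RelDust

end

noncomputable section

namespace RelDust

open scoped Topology ContDiff

/-! ### Joint regularity of primitives depending on a parameter -/

section ParametricIntegral

variable {H F : Type*} [NormedAddCommGroup H] [NormedSpace ℝ H] [ProperSpace H]
  [NormedAddCommGroup F] [NormedSpace ℝ F]

/-! The system is solved explicitly by characteristics `dX/dt = v/a`. Along one, issued from `y`
with velocity `w = ε v₀(y)`, the direction of `v` is constant and its length obeys a scalar ODE.
With `α = 1/a` this gives `v = α γ w`, `γ = (1 - (1 - α²)|w|²/c²)^(-1/2)`. Hence `X = y + ∫ α² γ w
ds`.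

Both expansion hypotheses serve to make `α²` integrable on `[0, ∞)` (`exists_inverseScale`). The
displacement is then, uniformly in time, Lipschitz in `y` with constant `O(ε)`. For small `ε` it is
1/2-Lipschitz, so characteristics never cross and `y ↦ X(t, y)` has a 2-Lipschitz, jointly `C¹`
inverse `Y` (`exists_contDiffAt_inverse`, `exists_isFlow`).

By Jacobi's formula the density equation integrates to `ρ = ε ρ₀(y) αⁿ γ / det D_yX`; this and the
formula for `v` solve the system (`IsFlow.exists_solution`). The factor `γ / det D_yX` is bounded
and Lipschitz in `y` uniformly in time (`exists_bddLip_densFactor`), so both `ρ` and, through the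
Lipschitz bound on `Y`, its gradient are `O(ε αⁿ)`.

Two devices keep the calculus global: a cut-off replaces `|w|²/c²` so that `γ` is smooth for every
`w`, and `α` is extended to negative times so that `t = 0` is an interior point. -/

theorem hasFDerivAt_intervalIntegral_of_continuous {f : H → ℝ → F} {f' : H → ℝ → H →L[ℝ] F}
    (hf : Continuous f.uncurry) (hf' : Continuous f'.uncurry)
    (hd : ∀ x s, HasFDerivAt (fun y => f y s) (f' x s) x) (a b : ℝ) (x : H) :
    HasFDerivAt (fun y => ∫ s in a..b, f y s) (∫ s in a..b, f' x s) x := by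
  have hK : IsCompact (Metric.closedBall x 1 ×ˢ uIcc a b) :=
    (isCompact_closedBall x 1).prod isCompact_uIcc
  obtain ⟨B, hB⟩ := hK.exists_bound_of_continuousOn hf'.continuousOn
  refine intervalIntegral.hasFDerivAt_integral_of_dominated_of_fderiv_le
    (bound := fun _ => B) (Metric.closedBall_mem_nhds x one_pos) ?_ ?_ ?_ ?_ ?_ ?_
  · exact Eventually.of_forall fun y => (hf.uncurry_left y).aestronglyMeasurable
  · exact (hf.uncurry_left x).intervalIntegrable _ _
  · exact (hf'.uncurry_left x).aestronglyMeasurable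
  · exact Eventually.of_forall fun s hs y hy => hB (y, s) ⟨hy, uIoc_subset_uIcc hs⟩
  · exact intervalIntegrable_const
  · exact Eventually.of_forall fun s _ y _ => hd y s

variable [CompleteSpace F]

/-- Both partial derivatives exist and are jointly continuous: the time one by the fundamental
theorem of calculus, the other by differentiation under the integral. -/
theorem hasFDerivAt_primitive_param {f : H → ℝ → F} {f' : H → ℝ → H →L[ℝ] F}
    (hf : Continuous f.uncurry) (hf' : Continuous f'.uncurry)
    (hd : ∀ x s, HasFDerivAt (fun y => f y s) (f' x s) x) (p : ℝ × H) :
    HasFDerivAt (fun q : ℝ × H => ∫ s in (0 : ℝ)..q.1, f q.2 s)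
      ((ContinuousLinearMap.toSpanSingleton ℝ (f p.2 p.1)).coprod
        (∫ s in (0 : ℝ)..p.1, f' p.2 s)) p := by
  have h := hasStrictFDerivAt_uncurry_coprod (𝕜 := ℝ) (u := p)
    (f := fun t y => ∫ s in (0 : ℝ)..t, f y s)
    (f₁ := fun t y => ContinuousLinearMap.toSpanSingleton ℝ (f y t))
    (f₂ := fun t y => ∫ s in (0 : ℝ)..t, f' y s) ?_ ?_ ?_ ?_
  · exact h.hasFDerivAt
  · refine Eventually.of_forall fun v => ?_
    exact ((hf.uncurry_left v.2).integral_hasStrictDerivAt 0 v.1).hasDerivAt.hasFDerivAt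
  · refine Eventually.of_forall fun v => ?_
    exact hasFDerivAt_intervalIntegral_of_continuous hf hf' hd 0 v.1 v.2
  · refine Continuous.continuousAt ?_
    have : Continuous fun v : ℝ × H => f v.2 v.1 := hf.comp (continuous_snd.prodMk continuous_fst)
    exact (ContinuousLinearMap.toSpanSingletonCLE (𝕜 := ℝ) (E := F)).continuous.comp this
  · refine Continuous.continuousAt ?_
    exact (intervalIntegral.continuous_parametric_primitive_of_continuous hf').comp
      (continuous_snd.prodMk continuous_fst)

theorem contDiff_primitive_param {f : H → ℝ → F} {f' : H → ℝ → H →L[ℝ] F}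
    (hf : Continuous f.uncurry) (hf' : Continuous f'.uncurry)
    (hd : ∀ x s, HasFDerivAt (fun y => f y s) (f' x s) x) :
    ContDiff ℝ 1 (fun q : ℝ × H => ∫ s in (0 : ℝ)..q.1, f q.2 s) := by
  refine contDiff_one_iff_hasFDerivAt.2 ⟨_, ?_, hasFDerivAt_primitive_param hf hf' hd⟩
  have h1 : Continuous fun v : ℝ × H => ContinuousLinearMap.toSpanSingleton ℝ (f v.2 v.1) :=
    (ContinuousLinearMap.toSpanSingletonCLE (𝕜 := ℝ) (E := F)).continuous.comp
      (hf.comp (continuous_snd.prodMk continuous_fst))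
  have h2 : Continuous fun v : ℝ × H => ∫ s in (0 : ℝ)..v.1, f' v.2 s :=
    (intervalIntegral.continuous_parametric_primitive_of_continuous hf').comp
      (continuous_snd.prodMk continuous_fst)
  have : Continuous fun v : ℝ × H => (ContinuousLinearMap.toSpanSingleton ℝ (f v.2 v.1)).comp
      (ContinuousLinearMap.fst ℝ ℝ H) + (∫ s in (0 : ℝ)..v.1, f' v.2 s).comp
      (ContinuousLinearMap.snd ℝ ℝ H) :=
    (h1.clm_comp continuous_const).add (h2.clm_comp continuous_const)
  refine this.congr fun v => ?_
  ext <;> simp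

end ParametricIntegral

/-! ### Inverting perturbations of the identity -/

section Inverse

variable {V : Type*} [NormedAddCommGroup V] [NormedSpace ℝ V] [FiniteDimensional ℝ V]

/-- A time-dependent `1/2`-Lipschitz perturbation of the identity has a jointly `C¹` inverse. -/
theorem exists_contDiffAt_inverse {Γ : ℝ → V → V} {Ω : Set ℝ} (hΩ : IsOpen Ω)
    (hC : ContDiff ℝ 1 (fun p : ℝ × V => Γ p.1 p.2))
    (hL : ∀ t ∈ Ω, ∀ y z, ‖Γ t y - Γ t z‖ ≤ 1 / 2 * ‖y - z‖) :
    ∃ Y : ℝ → V → V, ∀ t ∈ Ω, (∀ x, Y t x + Γ t (Y t x) = x) ∧ (∀ y, Y t (y + Γ t y) = y) ∧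
      (∀ x x', ‖Y t x - Y t x'‖ ≤ 2 * ‖x - x'‖) ∧
      ∀ x, ContDiffAt ℝ 1 (fun p : ℝ × V => Y p.1 p.2) (t, x) := by
  have : CompleteSpace V := FiniteDimensional.complete ℝ V
  have hex : ∀ t, ∀ x, ∃ y, t ∈ Ω → y + Γ t y = x := by
    intro t x
    by_cases ht : t ∈ Ω
    -- The preimage of `x` is the fixed point of the contraction `y ↦ x - Γ t y`.
    · have hc : ContractingWith (1 / 2) (fun y => x - Γ t y) := by
        refine ⟨by rw [div_lt_one] <;> norm_num, LipschitzWith.of_dist_le_mul fun y z => ?_⟩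
        rw [dist_eq_norm, dist_eq_norm, sub_sub_sub_cancel_left, norm_sub_rev]
        simpa using hL t ht y z
      refine ⟨hc.fixedPoint, fun _ => ?_⟩
      have := hc.fixedPoint_isFixedPt
      rw [Function.IsFixedPt] at this
      nth_rw 1 [← this]
      abel
    · exact ⟨0, fun h => absurd h ht⟩
  choose Y hY using hex
  have hlip : ∀ t ∈ Ω, ∀ y z, ‖y - z‖ ≤ 2 * ‖(y + Γ t y) - (z + Γ t z)‖ := by
    intro t ht y z
    have h1 := hL t ht y z
    have h2 : ‖y - z‖ ≤ ‖(y + Γ t y) - (z + Γ t z)‖ + ‖Γ t y - Γ t z‖ := by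
      refine le_trans (le_of_eq ?_) (norm_sub_le _ _)
      congr 1; abel
    linarith
  have hinj : ∀ t ∈ Ω, ∀ y z, y + Γ t y = z + Γ t z → y = z := by
    intro t ht y z h
    have := hlip t ht y z
    rw [h, sub_self, norm_zero, mul_zero] at this
    exact sub_eq_zero.1 (norm_le_zero_iff.1 this)
  have hYx : ∀ t ∈ Ω, ∀ x, Y t x + Γ t (Y t x) = x := fun t ht x => hY t x ht
  refine ⟨Y, fun t ht => ⟨hYx t ht, fun y => hinj t ht _ _ (hYx t ht _), fun x x' => ?_, fun x => ?_⟩⟩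
  · simpa [hYx t ht] using hlip t ht (Y t x) (Y t x')
  · let Φ : ℝ × V → ℝ × V := fun p => (p.1, p.2 + Γ p.1 p.2)
    have hΦ : ContDiff ℝ 1 Φ := contDiff_fst.prodMk (contDiff_snd.add hC)
    set y := Y t x with hy
    have hΦy : Φ (t, y) = (t, x) := by simp only [Φ]; rw [hYx t ht x]
    set D := fderiv ℝ Φ (t, y) with hD
    have hdΓ : DifferentiableAt ℝ (fun p : ℝ × V => Γ p.1 p.2) (t, y) :=
      hC.differentiable one_ne_zero _
    have hDd : HasFDerivAt Φ ((ContinuousLinearMap.fst ℝ ℝ V).prod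
        (ContinuousLinearMap.snd ℝ ℝ V + fderiv ℝ (fun p : ℝ × V => Γ p.1 p.2) (t, y))) (t, y) :=
      hasFDerivAt_fst.prodMk (hasFDerivAt_snd.add hdΓ.hasFDerivAt)
    -- A kernel vector has no time component, and its space component satisfies `η = -D_yΓ η` with
    -- `‖D_yΓ‖ ≤ 1/2`, so it vanishes.
    have hDinj : Function.Injective (D : ℝ × V →ₗ[ℝ] ℝ × V) := by
      rw [← LinearMap.ker_eq_bot, LinearMap.ker_eq_bot']
      rintro ⟨τ, η⟩ h
      rw [hD, hDd.fderiv] at h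
      simp only [ContinuousLinearMap.coe_coe, ContinuousLinearMap.prod_apply,
        ContinuousLinearMap.coe_fst', add_apply,
        ContinuousLinearMap.coe_snd', Prod.mk_eq_zero] at h
      obtain ⟨rfl, h⟩ := h
      have hpart : HasFDerivAt (fun z => Γ t z) ((fderiv ℝ (fun p : ℝ × V => Γ p.1 p.2) (t, y)).comp
          (ContinuousLinearMap.inr ℝ ℝ V)) y :=
        hdΓ.hasFDerivAt.comp y (hasFDerivAt_prodMk_right t y)
      have hn := hpart.le_of_lip' (C := 1 / 2) (by norm_num)
        (Eventually.of_forall fun z => hL t ht z y)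
      have := ContinuousLinearMap.le_of_opNorm_le _ hn η
      simp only [ContinuousLinearMap.comp_apply, ContinuousLinearMap.inr_apply] at this
      have h' : η = -fderiv ℝ (fun p : ℝ × V => Γ p.1 p.2) (t, y) (0, η) := eq_neg_of_add_eq_zero_left h
      have h3 : ‖η‖ ≤ 1 / 2 * ‖η‖ := by
        conv_lhs => rw [h', norm_neg]
        exact this
      have : ‖η‖ ≤ 0 := by linarith
      simp [norm_le_zero_iff.1 this]
    let e : (ℝ × V) ≃L[ℝ] (ℝ × V) :=
      (LinearEquiv.ofInjectiveEndo (D : ℝ × V →ₗ[ℝ] ℝ × V) hDinj).toContinuousLinearEquiv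
    have he : HasFDerivAt Φ (e : ℝ × V →L[ℝ] ℝ × V) (t, y) := by
      have : (e : ℝ × V →L[ℝ] ℝ × V) = D := by
        exact ContinuousLinearMap.ext fun z => rfl
      rw [this]
      exact (hΦ.differentiable one_ne_zero _).hasFDerivAt
    have hinv := hΦ.contDiffAt.to_localInverse he one_ne_zero
    rw [hΦy] at hinv
    have hev := (hΦ.contDiffAt.hasStrictFDerivAt' he one_ne_zero).eventually_right_inverse
    rw [hΦy] at hev
    have hΩ' : ∀ᶠ p : ℝ × V in 𝓝 (t, x), p.1 ∈ Ω :=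
      continuousAt_fst.eventually (hΩ.mem_nhds ht)
    -- Global injectivity at each time identifies `Y` with the local inverse.
    refine (contDiffAt_snd.comp _ hinv).congr_of_eventuallyEq ?_
    filter_upwards [hev, hΩ'] with p hp hpΩ
    change Y p.1 p.2 = (hΦ.contDiffAt.localInverse he one_ne_zero p).2
    change Φ (hΦ.contDiffAt.localInverse he one_ne_zero p) = p at hp
    generalize hΦ.contDiffAt.localInverse he one_ne_zero p = q at hp ⊢
    replace hp : Φ q = p := hp
    have hq1 : q.1 = p.1 := (Prod.ext_iff.1 hp).1
    have hq2 : q.2 + Γ q.1 q.2 = p.2 := (Prod.ext_iff.1 hp).2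
    refine hinj p.1 hpΩ _ _ ?_
    rw [hYx p.1 hpΩ, ← hq1, hq2]

end Inverse

/-! ### Jacobi's formula -/

section Determinant

variable {n : ℕ}

theorem det_eq_matrix_det (L : E n →L[ℝ] E n) :
    L.det = Matrix.det (Matrix.of fun i j => L (EuclideanSpace.single j 1) i) := by
  rw [ContinuousLinearMap.det, ← LinearMap.det_toMatrix (EuclideanSpace.basisFun (Fin n) ℝ).toBasis]
  congr 1

/-- The trace of an endomorphism of `ℝⁿ`. -/
def tr (L : E n →L[ℝ] E n) : ℝ := ∑ i, L (EuclideanSpace.single i 1) i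

theorem contDiff_det {k : WithTop ℕ∞} : ContDiff ℝ k fun L : E n →L[ℝ] E n => L.det := by
  simp only [det_eq_matrix_det, Matrix.det_apply, Matrix.of_apply]
  refine ContDiff.sum fun σ _ => ContDiff.const_smul _ (contDiff_prod fun i _ => ?_)
  exact ((EuclideanSpace.proj (σ i) : E n →L[ℝ] ℝ).comp
    (ContinuousLinearMap.apply ℝ (E n) (EuclideanSpace.single i (1 : ℝ)))).contDiff

/-- The determinant of `1 + X M` is a polynomial in `X` whose linear coefficient is the trace. -/
theorem hasDerivAt_det_one_add_smul (A : E n →L[ℝ] E n) :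
    HasDerivAt (fun s : ℝ => (1 + s • A).det) (tr A) 0 := by
  set M : Matrix (Fin n) (Fin n) ℝ := Matrix.of fun i j => A (EuclideanSpace.single j 1) i with hM
  have h1 : ∀ s : ℝ, (1 + s • A).det =
      (Matrix.det (1 + (Polynomial.X : Polynomial ℝ) • M.map Polynomial.C)).eval s := by
    intro s
    rw [det_eq_matrix_det, ← Polynomial.coe_evalRingHom, RingHom.map_det]
    congr 1
    ext i j
    simp only [hM, Polynomial.coe_evalRingHom, RingHom.mapMatrix_apply, Matrix.map_apply,
      Matrix.add_apply, Matrix.smul_apply, Matrix.of_apply, smul_eq_mul, Polynomial.eval_add,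
      Polynomial.eval_mul, Polynomial.eval_X, Polynomial.eval_C]
    by_cases hij : i = j
    · subst hij; simp
    · simp [hij]
  have h2 := (Matrix.det (1 + (Polynomial.X : Polynomial ℝ) • M.map Polynomial.C)).hasDerivAt 0
  rw [Matrix.derivative_det_one_add_X_smul] at h2
  simp only [h1]
  exact h2

theorem hasFDerivAt_det_one :
    ∃ D : (E n →L[ℝ] E n) →L[ℝ] ℝ, HasFDerivAt (fun L : E n →L[ℝ] E n => L.det) D 1 ∧
      ∀ A, D A = tr A := by
  refine ⟨_, (contDiff_det.differentiable one_ne_zero 1).hasFDerivAt, fun A => ?_⟩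
  have h := (contDiff_det (n := n).differentiable one_ne_zero 1).hasFDerivAt
  have h2 : HasDerivAt (fun s : ℝ => (1 : E n →L[ℝ] E n) + s • A) A 0 := by
    simpa using ((hasDerivAt_id (0 : ℝ)).smul_const A).const_add (1 : E n →L[ℝ] E n)
  have h0 : (1 : E n →L[ℝ] E n) = 1 + (0 : ℝ) • A := by
    ext x i; simp
  have h3 := HasFDerivAt.comp_hasDerivAt_of_eq (0 : ℝ) h h2 h0
  exact h3.unique (hasDerivAt_det_one_add_smul A)

/-- Jacobi's formula along a curve solving `M' = A M`. -/
theorem hasDerivAt_det_of_linear_ode {M : ℝ → E n →L[ℝ] E n} {A N : E n →L[ℝ] E n} {t : ℝ}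
    (hM : HasDerivAt M (A.comp (M t)) t) (hN : (M t).comp N = 1) (hN' : N.comp (M t) = 1) :
    HasDerivAt (fun s => (M s).det) (tr A * (M t).det) t := by
  obtain ⟨D, hD, hDA⟩ := hasFDerivAt_det_one (n := n)
  have h1 : HasDerivAt (fun s => (M s).comp N) A t := by
    have := hM.clm_comp (hasDerivAt_const t N)
    simpa [ContinuousLinearMap.comp_assoc, hN, ContinuousLinearMap.one_def] using this
  have h2 := (hD.comp_hasDerivAt_of_eq t h1 hN.symm).mul_const (M t).det
  rw [hDA] at h2
  refine h2.congr_of_eventuallyEq (Eventually.of_forall fun s => ?_)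
  -- Factoring out the fixed `M t` leaves a curve through the identity, where the derivative of the
  -- determinant is the trace.
  have : M s = ((M s).comp N).comp (M t) := by
    rw [ContinuousLinearMap.comp_assoc, hN', ContinuousLinearMap.one_def,
      ContinuousLinearMap.comp_id]
  change (M s).det = (((M s).comp N).det) * (M t).det
  conv_lhs => rw [this]
  simp [ContinuousLinearMap.det, LinearMap.det_comp]

end Determinant

/-! ### Primitives with weight `α²` -/

section WeightedPrimitive

variable {H F : Type*} [NormedAddCommGroup F] [NormedSpace ℝ F]

/-- The weighted primitive `∫₀ᵗ α(s)² ψ(α(s), w) ds`. -/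
def wprim (α : ℝ → ℝ) (ψ : ℝ × H → F) (t : ℝ) (w : H) : F :=
  ∫ s in (0 : ℝ)..t, α s ^ 2 • ψ (α s, w)

theorem norm_wprim_le {α : ℝ → ℝ} (hα : Continuous α) {ψ : ℝ × H → F} {A B t : ℝ} {w : H}
    (hA : |∫ s in (0 : ℝ)..t, α s ^ 2| ≤ A) (hB0 : 0 ≤ B) (hB : ∀ s, ‖ψ (α s, w)‖ ≤ B) :
    ‖wprim α ψ t w‖ ≤ A * B := by
  have h1 : ‖wprim α ψ t w‖ ≤ |∫ s in (0 : ℝ)..t, α s ^ 2 * B| := by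
    refine intervalIntegral.norm_integral_le_abs_of_norm_le (Eventually.of_forall fun s => ?_) ?_
    · rw [norm_smul, norm_pow, Real.norm_eq_abs, sq_abs]
      gcongr
      exact hB s
    · exact Continuous.intervalIntegrable (by fun_prop) _ _
  rw [intervalIntegral.integral_mul_const, abs_mul, abs_of_nonneg hB0] at h1
  exact h1.trans (by gcongr)

end WeightedPrimitive

/-! ### Spatial derivatives of weighted primitives -/

section PartialDerivative

variable {H F : Type*} [NormedAddCommGroup H] [NormedSpace ℝ H]
  [NormedAddCommGroup F] [NormedSpace ℝ F]

/-- The derivative of `ψ (s, w)` in `w`. -/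
def dsnd (ψ : ℝ × H → F) (p : ℝ × H) : H →L[ℝ] F :=
  (fderiv ℝ ψ p).comp (ContinuousLinearMap.inr ℝ ℝ H)

theorem contDiff_dsnd {ψ : ℝ × H → F} (hψ : ContDiff ℝ ∞ ψ) : ContDiff ℝ ∞ (dsnd ψ) :=
  (hψ.fderiv_right (m := ∞) (by simp)).clm_comp contDiff_const

theorem hasFDerivAt_dsnd {ψ : ℝ × H → F} (hψ : ContDiff ℝ ∞ ψ) (s : ℝ) (w : H) :
    HasFDerivAt (fun z => ψ (s, z)) (dsnd ψ (s, w)) w :=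
  (hψ.differentiable (by simp) (s, w)).hasFDerivAt.comp w (hasFDerivAt_prodMk_right s w)

/-- A `C¹` map is bounded and Lipschitz on a compact convex set. The interval `[0, 2]` contains all
values of the extended inverse scale factor, so the bound is uniform in time. -/
theorem exists_bound_lipschitz_on_ball [ProperSpace H] {ψ : ℝ × H → F} (hψ : ContDiff ℝ ∞ ψ)
    (R : ℝ) : ∃ B : ℝ, 0 ≤ B ∧ ∀ s ∈ Icc (0 : ℝ) 2, ∀ w ∈ Metric.closedBall (0 : H) R,
      ‖ψ (s, w)‖ ≤ B ∧
        ∀ z ∈ Metric.closedBall (0 : H) R, ‖ψ (s, w) - ψ (s, z)‖ ≤ B * ‖w - z‖ := by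
  have hK : IsCompact (Icc (0 : ℝ) 2 ×ˢ Metric.closedBall (0 : H) R) :=
    isCompact_Icc.prod (isCompact_closedBall _ _)
  obtain ⟨B, hB⟩ := hK.exists_bound_of_continuousOn hψ.continuous.continuousOn
  obtain ⟨L, hL⟩ := hψ.contDiffOn.exists_lipschitzOnWith (by simp)
    ((convex_Icc (0 : ℝ) 2).prod (convex_closedBall (0 : H) R)) hK
  refine ⟨max B L, le_max_of_le_right L.2, fun s hs w hw => ⟨(hB _ ⟨hs, hw⟩).trans (le_max_left _ _),
    fun z hz => ?_⟩⟩
  have := hL.norm_sub_le (x := (s, w)) (y := (s, z)) ⟨hs, hw⟩ ⟨hs, hz⟩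
  simp only [Prod.mk_sub_mk, sub_self] at this
  refine this.trans ?_
  have h2 : ‖((0 : ℝ), w - z)‖ = ‖w - z‖ := by simp [Prod.norm_def]
  rw [h2]
  gcongr
  exact le_max_right _ _

theorem continuous_wprim_integrand {α : ℝ → ℝ} (hα : Continuous α) {ψ : ℝ × H → F}
    (hψ : ContDiff ℝ ∞ ψ) :
    Continuous (Function.uncurry fun (w : H) (s : ℝ) => α s ^ 2 • ψ (α s, w)) := by
  have := hψ.continuous
  simp only [Function.uncurry_def]
  fun_prop

theorem hasFDerivAt_wprim_integrand {α : ℝ → ℝ} {ψ : ℝ × H → F}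
    (hψ : ContDiff ℝ ∞ ψ) (w : H) (s : ℝ) :
    HasFDerivAt (fun z : H => α s ^ 2 • ψ (α s, z)) (α s ^ 2 • dsnd ψ (α s, w)) w :=
  (hasFDerivAt_dsnd hψ (α s) w).const_smul _

theorem hasFDerivAt_wprim [ProperSpace H] {α : ℝ → ℝ} (hα : Continuous α) {ψ : ℝ × H → F}
    (hψ : ContDiff ℝ ∞ ψ) (t : ℝ) (w : H) :
    HasFDerivAt (wprim α ψ t) (wprim α (dsnd ψ) t w) w :=
  hasFDerivAt_intervalIntegral_of_continuous (continuous_wprim_integrand hα hψ)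
    (continuous_wprim_integrand hα (contDiff_dsnd hψ)) (hasFDerivAt_wprim_integrand hψ) 0 t w

theorem contDiff_wprim [ProperSpace H] [CompleteSpace F] {α : ℝ → ℝ} (hα : Continuous α)
    {ψ : ℝ × H → F} (hψ : ContDiff ℝ ∞ ψ) :
    ContDiff ℝ 1 fun p : ℝ × H => wprim α ψ p.1 p.2 :=
  contDiff_primitive_param (continuous_wprim_integrand hα hψ)
    (continuous_wprim_integrand hα (contDiff_dsnd hψ)) (hasFDerivAt_wprim_integrand hψ)

theorem hasDerivAt_wprim [CompleteSpace F] {α : ℝ → ℝ} (hα : Continuous α) {ψ : ℝ × H → F}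
    (hψ : ContDiff ℝ ∞ ψ) (t : ℝ) (w : H) :
    HasDerivAt (fun s => wprim α ψ s w) (α t ^ 2 • ψ (α t, w)) t :=
  (((continuous_wprim_integrand hα hψ).uncurry_left w).integral_hasStrictDerivAt 0 t).hasDerivAt

theorem norm_wprim_sub_le {α : ℝ → ℝ} (hα : Continuous α) {ψ : ℝ × H → F} (hψ : ContDiff ℝ ∞ ψ)
    {A B t : ℝ} {w z : H} (hA : |∫ s in (0 : ℝ)..t, α s ^ 2| ≤ A) (hB0 : 0 ≤ B)
    (hB : ∀ s, ‖ψ (α s, w) - ψ (α s, z)‖ ≤ B * ‖w - z‖) :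
    ‖wprim α ψ t w - wprim α ψ t z‖ ≤ A * B * ‖w - z‖ := by
  have h0 : wprim α ψ t w - wprim α ψ t z =
      wprim α (fun p : ℝ × Unit => ψ (p.1, w) - ψ (p.1, z)) t () := by
    simp only [wprim, smul_sub]
    rw [intervalIntegral.integral_sub]
    · exact ((continuous_wprim_integrand hα hψ).uncurry_left w).intervalIntegrable _ _
    · exact ((continuous_wprim_integrand hα hψ).uncurry_left z).intervalIntegrable _ _
  rw [h0, mul_assoc]
  exact norm_wprim_le hα hA (by positivity) hB

end PartialDerivative

/-! ### The explicit Lorentz factor -/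

section LorentzFactor

variable {n : ℕ}

/-- Capping the squared speed at 1/2 keeps the radicand of the Lorentz factor positive for every
`w`; small data only see the region where nothing was changed. -/
theorem exists_cutoff_normSq (n : ℕ) {c : ℝ} (hc : 0 < c) :
    ∃ χ : E n → ℝ, ContDiff ℝ ∞ χ ∧ (∀ w, 0 ≤ χ w) ∧ (∀ w, χ w ≤ 1 / 2) ∧
      ∀ w, ‖w‖ ≤ c / 4 → χ w = ‖w‖ ^ 2 / c ^ 2 := by
  let f : ContDiffBump (0 : E n) := ⟨c / 4, c / 2, by positivity, by linarith⟩
  refine ⟨fun w => f w * (‖w‖ ^ 2 / c ^ 2), f.contDiff.mul ((contDiff_norm_sq ℝ).div_const _),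
    fun w => mul_nonneg f.nonneg (by positivity), fun w => ?_, fun w hw => ?_⟩
  · rcases le_or_gt (c / 2) ‖w‖ with h | h
    · beta_reduce
      rw [f.zero_of_le_dist (by simpa [f] using h)]
      norm_num
    · have h1 : ‖w‖ ^ 2 / c ^ 2 ≤ 1 / 2 := by
        rw [div_le_iff₀ (by positivity)]
        nlinarith [norm_nonneg w]
      calc f w * (‖w‖ ^ 2 / c ^ 2) ≤ 1 * (1 / 2) :=
            mul_le_mul f.le_one h1 (by positivity) zero_le_one
        _ = 1 / 2 := one_mul _
  · beta_reduce
    rw [f.one_of_mem_closedBall (by simpa [f] using hw), one_mul]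

/-- The Lorentz factor along a characteristic, normalised by its initial value: `s` is the inverse
scale factor and `χ w` the initial squared speed in units of the speed of light. -/
def lorentz (χ : E n → ℝ) (p : ℝ × E n) : ℝ := (√(1 - (1 - p.1 ^ 2) * χ p.2))⁻¹

/-- The velocity along a characteristic with initial velocity `p.2` is `s • momentum χ (s, w)`. -/
def momentum (χ : E n → ℝ) (p : ℝ × E n) : E n := lorentz χ p • p.2

theorem radicand_pos {χ : E n → ℝ} (h0 : ∀ w, 0 ≤ χ w) (h1 : ∀ w, χ w ≤ 1 / 2) (s : ℝ) (w : E n) :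
    0 < 1 - (1 - s ^ 2) * χ w := by
  have := mul_nonneg (sq_nonneg s) (h0 w)
  linarith [h1 w]

theorem contDiff_lorentz {χ : E n → ℝ} (hχ : ContDiff ℝ ∞ χ) (h0 : ∀ w, 0 ≤ χ w)
    (h1 : ∀ w, χ w ≤ 1 / 2) : ContDiff ℝ ∞ (lorentz χ) := by
  have h : ContDiff ℝ ∞ fun p : ℝ × E n => 1 - (1 - p.1 ^ 2) * χ p.2 :=
    contDiff_const.sub ((contDiff_const.sub (contDiff_fst.pow 2)).mul (hχ.comp contDiff_snd))
  refine (h.sqrt fun p => (radicand_pos h0 h1 p.1 p.2).ne').inv fun p => ?_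
  exact (Real.sqrt_pos.2 (radicand_pos h0 h1 p.1 p.2)).ne'

theorem contDiff_momentum {χ : E n → ℝ} (hχ : ContDiff ℝ ∞ χ) (h0 : ∀ w, 0 ≤ χ w)
    (h1 : ∀ w, χ w ≤ 1 / 2) : ContDiff ℝ ∞ (momentum χ) :=
  (contDiff_lorentz hχ h0 h1).smul contDiff_snd

theorem lorentz_sq {χ : E n → ℝ} (h0 : ∀ w, 0 ≤ χ w) (h1 : ∀ w, χ w ≤ 1 / 2) (s : ℝ) (w : E n) :
    lorentz χ (s, w) ^ 2 * (1 - (1 - s ^ 2) * χ w) = 1 := by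
  have h := radicand_pos h0 h1 s w
  rw [lorentz, inv_pow, Real.sq_sqrt h.le, inv_mul_cancel₀ h.ne']

theorem lorentz_one (χ : E n → ℝ) (w : E n) : lorentz χ (1, w) = 1 := by simp [lorentz]

theorem lorentz_pos {χ : E n → ℝ} (h0 : ∀ w, 0 ≤ χ w) (h1 : ∀ w, χ w ≤ 1 / 2) (p : ℝ × E n) :
    0 < lorentz χ p := inv_pos.2 (Real.sqrt_pos.2 (radicand_pos h0 h1 _ _))

/-- When `α' = -(a'/a) α`, the logarithmic derivative is `(a'/a) |v|²/c²`, which is the source term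
needed in both the velocity and the density equations. -/
theorem hasDerivAt_lorentz {χ : E n → ℝ} (h0 : ∀ w, 0 ≤ χ w) (h1 : ∀ w, χ w ≤ 1 / 2)
    {α : ℝ → ℝ} {α' t : ℝ} (hα : HasDerivAt α α' t) (w : E n) :
    HasDerivAt (fun s => lorentz χ (α s, w))
      (-(lorentz χ (α t, w) ^ 3 * α t * α' * χ w)) t := by
  have h := radicand_pos h0 h1 (α t) w
  have hs := Real.sqrt_pos.2 h
  have hd : HasDerivAt (fun s => 1 - (1 - α s ^ 2) * χ w) (2 * α t * α' * χ w) t := by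
    convert! (((hα.pow 2).const_sub 1).mul_const (χ w)).const_sub 1 using 1
    simp
  convert! (hd.sqrt h.ne').inv hs.ne' using 1
  simp only [lorentz]
  field_simp

end LorentzFactor

/-- A `C¹` extension to `ℝ` of the inverse of a scale factor, together with the integrability of
its square on `[0, ∞)`. -/
structure InverseScale (a α : ℝ → ℝ) (A : ℝ) : Prop where
  contDiff : ContDiff ℝ 1 α
  eq_inv : ∀ t, 0 ≤ t → α t = (a t)⁻¹
  mem_Icc : ∀ t, α t ∈ Icc (0 : ℝ) 2
  le_one : ∀ t, 0 ≤ t → α t ≤ 1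
  pos : ∀ t, 0 ≤ t → 0 < α t
  integral_sq_le : ∀ t, -1 < t → |∫ s in (0 : ℝ)..t, α s ^ 2| ≤ A
  tendsto_zero : Tendsto α atTop (𝓝 0)
  hasDerivAt : ∀ t, 0 ≤ t → HasDerivAt α (-(tderiv a t / a t * α t)) t

/-! ### The inverse scale factor and integrability of its square -/

namespace IsScaleFactor

variable {a : ℝ → ℝ}

theorem hasDerivWithinAt (ha : IsScaleFactor a) {t : ℝ} (ht : 0 ≤ t) :
    HasDerivWithinAt a (tderiv a t) (Ici 0) t :=
  (ha.diff t ht).hasDerivWithinAt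

/-- The even reflection of `a'/a²` is continuous on the line, so its primitive extends `1/a` to a
`C¹` function past `t = 0`. -/
theorem continuous_evenDeriv (ha : IsScaleFactor a) :
    Continuous fun s : ℝ => tderiv a |s| / a |s| ^ 2 := by
  have h1 : Continuous fun s : ℝ => tderiv a |s| :=
    ha.diff_tderiv.continuousOn.comp_continuous continuous_abs fun s => abs_nonneg s
  have h2 : Continuous fun s : ℝ => a |s| :=
    ha.diff.continuousOn.comp_continuous continuous_abs fun s => abs_nonneg s
  exact h1.div (h2.pow 2) fun s => (pow_pos (ha.pos _ (abs_nonneg s)) 2).ne'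

theorem inv_eq_integral (ha : IsScaleFactor a) {t : ℝ} (ht : 0 ≤ t) :
    1 - ∫ s in (0 : ℝ)..t, tderiv a |s| / a |s| ^ 2 = (a t)⁻¹ := by
  have hd : ∀ s, 0 ≤ s → HasDerivWithinAt (fun r => (a r)⁻¹) (-(tderiv a |s| / a |s| ^ 2)) (Ici 0) s := by
    intro s hs
    rw [abs_of_nonneg hs, ← neg_div]
    exact (ha.hasDerivWithinAt hs).inv (ha.pos s hs).ne'
  have h := intervalIntegral.integral_eq_sub_of_hasDeriv_right_of_le ht
    (f := fun r => (a r)⁻¹) (f' := fun s => -(tderiv a |s| / a |s| ^ 2))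
    (fun s hs => (hd s hs.1).continuousWithinAt.mono Icc_subset_Ici_self)
    (fun s hs => (hd s hs.1.le).mono fun r hr => (hs.1.trans hr).le)
    (ha.continuous_evenDeriv.neg.intervalIntegrable _ _)
  rw [intervalIntegral.integral_neg, ha.init] at h
  rw [sub_eq_add_neg, h]
  simp

theorem one_le (ha : IsScaleFactor a) (hpos : ∀ t, 0 ≤ t → 0 < tderiv a t) {t : ℝ} (ht : 0 ≤ t) :
    1 ≤ a t := by
  have h := ha.inv_eq_integral ht
  have h2 : 0 ≤ ∫ s in (0 : ℝ)..t, tderiv a |s| / a |s| ^ 2 :=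
    intervalIntegral.integral_nonneg ht fun s _ =>
      div_nonneg (hpos _ (abs_nonneg s)).le (sq_nonneg _)
  have h3 : (a t)⁻¹ ≤ 1 := by linarith
  exact (inv_le_one₀ (ha.pos t ht)).1 h3

/-- If the square of the inverse scale factor has bounded integral, then the inverse scale factor
has the extension required of `InverseScale`. -/
theorem exists_inverseScale (ha : IsScaleFactor a) (hpos : ∀ t, 0 ≤ t → 0 < tderiv a t) {A : ℝ}
    (hA : ∀ α : ℝ → ℝ, Continuous α → (∀ t, 0 ≤ t → α t = (a t)⁻¹) →
      (∀ t, 0 ≤ t → HasDerivAt α (-(tderiv a t / a t ^ 2)) t) →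
      ∀ t, 0 ≤ t → ∫ s in (0 : ℝ)..t, α s ^ 2 ≤ A) :
    ∃ α, InverseScale a α (max A 4) := by
  set g : ℝ → ℝ := fun s => tderiv a |s| / a |s| ^ 2 with hg
  have hgc : Continuous g := ha.continuous_evenDeriv
  set α : ℝ → ℝ := fun t => 1 - ∫ s in (0 : ℝ)..t, g s with hα
  have hd : ∀ t, HasDerivAt α (-g t) t := fun t =>
    (hgc.integral_hasStrictDerivAt 0 t).hasDerivAt.const_sub 1
  have hC : ContDiff ℝ 1 α := by
    refine contDiff_one_iff_deriv.2 ⟨fun t => (hd t).differentiableAt, ?_⟩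
    rw [funext fun t => (hd t).deriv]
    exact hgc.neg
  have heq : ∀ t, 0 ≤ t → α t = (a t)⁻¹ := fun t ht => ha.inv_eq_integral ht
  have hp : ∀ t, 0 ≤ t → 0 < α t := fun t ht => by rw [heq t ht]; exact inv_pos.2 (ha.pos t ht)
  have hle : ∀ t, 0 ≤ t → α t ≤ 1 := fun t ht => by
    rw [heq t ht]; exact inv_le_one_of_one_le₀ (ha.one_le hpos ht)
  -- This symmetry about the value 1 confines the extension to `[0, 2]` for negative times.
  have hodd : ∀ t, α (-t) = 2 - α t := by
    intro t
    have : ∫ s in (0 : ℝ)..(-t), g s = -∫ s in (0 : ℝ)..t, g s := by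
      have h1 : ∀ s, g s = g (-s) := fun s => by simp [hg]
      rw [intervalIntegral.integral_congr (g := fun s => g (-s)) fun s _ => h1 s,
        intervalIntegral.integral_comp_neg, neg_neg, neg_zero, intervalIntegral.integral_symm]
    simp only [hα, this]
    ring
  have hmem : ∀ t, α t ∈ Icc (0 : ℝ) 2 := by
    intro t
    rcases le_total 0 t with ht | ht
    · exact ⟨(hp t ht).le, (hle t ht).trans one_le_two⟩
    · have h1 := hodd (-t)
      rw [neg_neg] at h1
      have h2 := (hp (-t) (neg_nonneg.2 ht)).le
      have h3 := hle (-t) (neg_nonneg.2 ht)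
      constructor <;> linarith
  have hd' : ∀ t, 0 ≤ t → HasDerivAt α (-(tderiv a t / a t ^ 2)) t := fun t ht => by
    simpa [hg, abs_of_nonneg ht] using hd t
  have hint : ∀ t, 0 ≤ t → ∫ s in (0 : ℝ)..t, α s ^ 2 ≤ A := hA α hC.continuous heq hd'
  have hanti : AntitoneOn α (Ici 0) := by
    refine antitoneOn_of_deriv_nonpos (convex_Ici 0) hC.continuous.continuousOn
      (fun t _ => (hd t).differentiableAt.differentiableWithinAt) fun t _ => ?_
    rw [(hd t).deriv, neg_nonpos]
    exact div_nonneg (hpos _ (abs_nonneg t)).le (sq_nonneg _)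
  refine ⟨α, hC, heq, hmem, hle, hp, fun t ht => ?_, ?_, fun t ht => ?_⟩
  · rcases le_total 0 t with h | h
    · rw [abs_of_nonneg (intervalIntegral.integral_nonneg h fun s _ => sq_nonneg _)]
      exact (hint t h).trans (le_max_left _ _)
    -- For `-1 < t ≤ 0` the integrand is at most `2² = 4` on an interval of length below 1; hence
    -- the 4 in `max A 4`.
    · have h1 := intervalIntegral.norm_integral_le_of_norm_le_const (a := 0) (b := t)
        (f := fun s => α s ^ 2) (C := 4) fun s _ => by
          have := hmem s
          rw [Real.norm_eq_abs, abs_of_nonneg (sq_nonneg _)]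
          nlinarith [this.1, this.2]
      rw [Real.norm_eq_abs] at h1
      refine h1.trans (le_max_of_le_right ?_)
      rw [sub_zero, abs_of_nonpos h]
      linarith
  -- Since `α` decreases, `t α(t)² ≤ ∫₀ᵗ α² ≤ A`.
  · have hsq : Tendsto (fun t => α t ^ 2) atTop (𝓝 0) := by
      refine squeeze_zero' (Eventually.of_forall fun t => sq_nonneg _) ?_
        (tendsto_const_nhds.div_atTop tendsto_id : Tendsto (fun t : ℝ => A / t) atTop (𝓝 0))
      filter_upwards [eventually_gt_atTop 0] with t ht
      rw [le_div_iff₀ ht]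
      refine le_trans ?_ (hint t ht.le)
      calc α t ^ 2 * t = ∫ s in (0 : ℝ)..t, α t ^ 2 := by simp [mul_comm]
        _ ≤ _ := intervalIntegral.integral_mono_on ht.le (by simp)
          ((hC.continuous.pow 2).intervalIntegrable _ _) fun s hs =>
            pow_le_pow_left₀ (hp t ht.le).le (hanti hs.1 ht.le hs.2) 2
    have := hsq.sqrt
    simp only [Real.sqrt_zero, Real.sqrt_sq (hmem _).1] at this
    exact this
  · convert! hd' t ht using 2
    rw [heq t ht]
    field_simp

end IsScaleFactor

theorem exists_inverseScale {a : ℝ → ℝ} (ha : IsScaleFactor a)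
    (hH : AssumptionH1 a ∨ AssumptionH2 a) : ∃ α A, InverseScale a α A := by
  -- A nonnegative `F` with `F' ≤ -α²` makes `∫₀ᵗ α² + F(t)` nonincreasing, which bounds the
  -- integral by `F 0`.
  have main : ∀ {F F' : ℝ → ℝ} {A : ℝ} {α : ℝ → ℝ}, Continuous α →
      (∀ t, 0 ≤ t → HasDerivAt F (F' t) t) → (∀ t, 0 ≤ t → α t ^ 2 + F' t ≤ 0) →
      F 0 ≤ A → (∀ t, 0 ≤ t → 0 ≤ F t) → ∀ t, 0 ≤ t → ∫ s in (0 : ℝ)..t, α s ^ 2 ≤ A := by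
    intro F F' A α hα hF hle hF0 hFp t ht
    have hd : ∀ t, 0 ≤ t →
        HasDerivAt (fun t => (∫ s in (0 : ℝ)..t, α s ^ 2) + F t) (α t ^ 2 + F' t) t := fun t ht =>
      (((hα.pow 2).integral_hasStrictDerivAt 0 t).hasDerivAt).add (hF t ht)
    have hanti := antitoneOn_of_deriv_nonpos (convex_Ici 0)
      (fun t ht => (hd t ht).continuousAt.continuousWithinAt)
      (fun t ht => (hd t (interior_subset ht)).differentiableAt.differentiableWithinAt)
      (fun t ht => by rw [(hd t (interior_subset ht)).deriv]; exact hle t (interior_subset ht))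
    have := hanti (self_mem_Ici) ht ht
    simp only [intervalIntegral.integral_same, zero_add] at this
    linarith [hFp t ht]
  rcases hH with h | h
  · have hb : 0 < tderiv a 0 := (h 0 le_rfl).1
    have hmono : MonotoneOn (tderiv a) (Ici 0) := by
      refine monotoneOn_of_deriv_nonneg (convex_Ici 0) ha.diff_tderiv.continuousOn
        (ha.diff_tderiv.mono interior_subset) fun t ht => ?_
      rw [interior_Ici] at ht
      rw [← derivWithin_of_mem_nhds (Ici_mem_nhds ht)]
      exact (h t (le_of_lt ht)).2
    refine Exists.imp (fun α hα => ⟨_, hα⟩)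
      (ha.exists_inverseScale (fun t ht => (h t ht).1) (A := (tderiv a 0)⁻¹) ?_)
    -- Take `F = α / a'(0)`: since `a'` is nondecreasing, `-F' = a'/(a'(0) a²) ≥ α²`.
    · intro α hc heq hd
      refine main hc (fun t ht => (hd t ht).mul_const (tderiv a 0)⁻¹) (fun t ht => ?_) ?_ ?_
      · have h1 := hmono (self_mem_Ici) ht ht
        have h2 := ha.pos t ht
        rw [heq t ht]
        have : 1 ≤ tderiv a t * (tderiv a 0)⁻¹ := by
          rw [← div_eq_mul_inv, one_le_div hb]; exact h1
        have h3 : (a t)⁻¹ ^ 2 + -(tderiv a t / a t ^ 2) * (tderiv a 0)⁻¹ =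
            (1 - tderiv a t * (tderiv a 0)⁻¹) * ((a t)⁻¹ ^ 2) := by
          field_simp
          ring
        rw [h3]
        exact mul_nonpos_of_nonpos_of_nonneg (by linarith) (sq_nonneg _)
      · rw [heq 0 le_rfl, ha.init]; simp
      · intro t ht
        rw [heq t ht]
        have := ha.pos t ht
        positivity
  · obtain ⟨h, δ, hδ, -, hδa⟩ := h
    refine Exists.imp (fun α hα => ⟨_, hα⟩)
      (ha.exists_inverseScale (fun t ht => (h t ht).1) (A := δ⁻¹) ?_)
    · intro α hc heq hd
      -- Here `F` is the tail integral of `(1 + t)^(-1-δ)`, which dominates `α²`.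
      refine main hc (F := fun t => δ⁻¹ * (1 + t) ^ (-δ)) (F' := fun t => -(1 + t) ^ (-δ - 1))
        (fun t ht => ?_) (fun t ht => ?_) (by simp) fun t ht => ?_
      · have hp : (1 + t) ≠ 0 := by positivity
        convert! (((hasDerivAt_id t).const_add 1).rpow_const (p := -δ) (Or.inl hp)).const_mul δ⁻¹
          using 1
        simp only [id]
        field_simp
      · have hp : 0 < 1 + t := by positivity
        have h1 : (1 + t) ^ (1 + δ) ≤ a t ^ 2 := by
          have := pow_le_pow_left₀ (Real.rpow_nonneg hp.le _) (hδa t ht) 2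
          rwa [← Real.rpow_natCast, ← Real.rpow_mul hp.le, Nat.cast_ofNat,
            div_mul_cancel₀ _ two_ne_zero] at this
        have h2 : (1 + t) ^ (-δ - 1) = ((1 + t) ^ (1 + δ))⁻¹ := by
          rw [← Real.rpow_neg hp.le]; congr 1; ring
        rw [heq t ht, inv_pow, h2]
        have := inv_anti₀ (Real.rpow_pos_of_pos hp _) h1
        linarith
      · positivity

/-! ### Differentiation along curves -/

section MaterialDerivative

variable {n : ℕ}

theorem clm_apply_eq_sum (L : E n →L[ℝ] ℝ) (ξ : E n) :
    L ξ = ∑ j, ξ j * L (EuclideanSpace.single j 1) := by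
  conv_lhs => rw [← (EuclideanSpace.basisFun (Fin n) ℝ).sum_repr ξ]
  simp

/-- Derivative of a field along a curve in terms of the partial derivatives `pt` and `px`. -/
theorem hasDerivAt_along {f : ℝ → E n → ℝ} {t : ℝ} {x ξ : E n} {X : ℝ → E n} (ht : 0 ≤ t)
    (hf : DifferentiableAt ℝ (fun p : ℝ × E n => f p.1 p.2) (t, x)) (hX : HasDerivAt X ξ t)
    (hXt : X t = x) :
    HasDerivAt (fun s => f s (X s)) (pt f t x + ∑ j, ξ j * px j f t x) t := by
  set D := fderiv ℝ (fun p : ℝ × E n => f p.1 p.2) (t, x) with hD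
  have hpt : pt f t x = D (1, 0) := by
    have h : HasDerivAt (fun s => f s x) (D (1, 0)) t :=
      hf.hasFDerivAt.comp_hasDerivAt (f := fun s => (s, x)) t ((hasDerivAt_id t).prodMk (hasDerivAt_const t x))
    exact h.hasDerivWithinAt.derivWithin (uniqueDiffOn_Ici 0 t ht)
  have hpx : ∀ j, px j f t x = D (0, EuclideanSpace.single j 1) := fun j => by
    have h : HasFDerivAt (f t) (D.comp (ContinuousLinearMap.inr ℝ ℝ (E n))) x :=
      hf.hasFDerivAt.comp x (hasFDerivAt_prodMk_right t x)
    rw [px, h.fderiv]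
    rfl
  have h := hf.hasFDerivAt.comp_hasDerivAt_of_eq t ((hasDerivAt_id t).prodMk hX)
    (by rw [id, hXt])
  convert! h using 1
  have h2 : ((1 : ℝ), ξ) = (1, 0) + (0, ξ) := by simp
  rw [← hD, h2, map_add, hpt]
  congr 1
  simp only [hpx]
  exact (clm_apply_eq_sum (D.comp (ContinuousLinearMap.inr ℝ ℝ (E n))) ξ).symm

end MaterialDerivative

/-! ### The characteristic flow and the solution it defines -/

section Flow

variable {n : ℕ} {a α : ℝ → ℝ} {A : ℝ} {χ : E n → ℝ} {w : E n → E n}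

/-- The displacement at time `t` along the characteristic issued from `y`. -/
def disp (α : ℝ → ℝ) (χ : E n → ℝ) (w : E n → E n) (t : ℝ) (y : E n) : E n :=
  wprim α (momentum χ) t (w y)

/-- The deformation gradient of the characteristic flow. -/
def deform (α : ℝ → ℝ) (χ : E n → ℝ) (w : E n → E n) (t : ℝ) (y : E n) : E n →L[ℝ] E n :=
  1 + (wprim α (dsnd (momentum χ)) t (w y)).comp (fderiv ℝ w y)

/-- The data of a characteristic flow: inverse scale factor, cut-off and initial velocity `w`. -/
structure IsFlow (c : ℝ) (a α : ℝ → ℝ) (A : ℝ) (χ : E n → ℝ) (w : E n → E n) : Prop where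
  light : 0 < c
  scale : InverseScale a α A
  smooth_cutoff : ContDiff ℝ ∞ χ
  cutoff_nonneg : ∀ z, 0 ≤ χ z
  cutoff_le : ∀ z, χ z ≤ 1 / 2
  cutoff_eq : ∀ y, χ (w y) = ‖w y‖ ^ 2 / c ^ 2
  contDiff_init : ContDiff ℝ 2 w
  lipschitz_disp : ∀ t ∈ Ioi (-1 : ℝ), ∀ y z,
    ‖disp α χ w t y - disp α χ w t z‖ ≤ 1 / 2 * ‖y - z‖

theorem disp_zero (y : E n) : disp α χ w 0 y = 0 := by simp [disp, wprim]

theorem deform_zero (y : E n) : deform α χ w 0 y = 1 := by simp [deform, wprim]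

namespace IsFlow

variable {c : ℝ}

theorem smooth_momentum (h : IsFlow c a α A χ w) : ContDiff ℝ ∞ (momentum χ) :=
  contDiff_momentum h.smooth_cutoff h.cutoff_nonneg h.cutoff_le

theorem contDiff_disp (h : IsFlow c a α A χ w) :
    ContDiff ℝ 1 fun p : ℝ × E n => disp α χ w p.1 p.2 :=
  (contDiff_wprim h.scale.contDiff.continuous h.smooth_momentum).comp
    (contDiff_fst.prodMk ((h.contDiff_init.of_le one_le_two).comp contDiff_snd))

theorem contDiff_deform (h : IsFlow c a α A χ w) :
    ContDiff ℝ 1 fun p : ℝ × E n => deform α χ w p.1 p.2 := by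
  have h1 : ContDiff ℝ 1 fun p : ℝ × E n => wprim α (dsnd (momentum χ)) p.1 (w p.2) :=
    (contDiff_wprim h.scale.contDiff.continuous (contDiff_dsnd h.smooth_momentum)).comp
      (contDiff_fst.prodMk ((h.contDiff_init.of_le one_le_two).comp contDiff_snd))
  have h2 : ContDiff ℝ 1 fun p : ℝ × E n => fderiv ℝ w p.2 :=
    (h.contDiff_init.fderiv_right (m := 1) (by norm_num)).comp contDiff_snd
  exact contDiff_const.add (h1.clm_comp h2)

theorem hasFDerivAt_init (h : IsFlow c a α A χ w) (y : E n) : HasFDerivAt w (fderiv ℝ w y) y :=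
  (h.contDiff_init.differentiable two_ne_zero y).hasFDerivAt

theorem hasFDerivAt_disp (h : IsFlow c a α A χ w) (t : ℝ) (y : E n) :
    HasFDerivAt (disp α χ w t) (deform α χ w t y - 1) y := by
  rw [deform, add_sub_cancel_left]
  exact (hasFDerivAt_wprim h.scale.contDiff.continuous h.smooth_momentum t (w y)).comp y
    (h.hasFDerivAt_init y)

theorem hasFDerivAt_position (h : IsFlow c a α A χ w) (t : ℝ) (y : E n) :
    HasFDerivAt (fun z => z + disp α χ w t z) (deform α χ w t y) y := by
  have := (hasFDerivAt_id y).add (h.hasFDerivAt_disp t y)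
  rwa [← ContinuousLinearMap.one_def, add_sub_cancel] at this

theorem hasDerivAt_position (h : IsFlow c a α A χ w) (t : ℝ) (y : E n) :
    HasDerivAt (fun s => y + disp α χ w s y) (α t ^ 2 • momentum χ (α t, w y)) t :=
  (hasDerivAt_wprim h.scale.contDiff.continuous h.smooth_momentum t (w y)).const_add y

theorem hasDerivAt_deform (h : IsFlow c a α A χ w) (t : ℝ) (y : E n) :
    HasDerivAt (fun s => deform α χ w s y)
      ((α t ^ 2 • dsnd (momentum χ) (α t, w y)).comp (fderiv ℝ w y)) t := by
  have := (hasDerivAt_wprim h.scale.contDiff.continuous (contDiff_dsnd h.smooth_momentum) t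
    (w y)).clm_comp (hasDerivAt_const t (fderiv ℝ w y))
  simpa [deform] using this.const_add 1

/-- The derivative of a 1/2-Lipschitz displacement has norm at most 1/2; this keeps the deformation
gradient invertible at all times. -/
theorem norm_deform_sub_one_le (h : IsFlow c a α A χ w) {t : ℝ} (ht : -1 < t) (y : E n) :
    ‖deform α χ w t y - 1‖ ≤ 1 / 2 :=
  (h.hasFDerivAt_disp t y).le_of_lip' (by norm_num)
    (Eventually.of_forall fun z => h.lipschitz_disp t ht z y)

end IsFlow

theorem exists_inverse_of_norm_sub_one_le {M : E n →L[ℝ] E n} (hM : ‖M - 1‖ ≤ 1 / 2) :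
    ∃ N : E n →L[ℝ] E n, M.comp N = 1 ∧ N.comp M = 1 := by
  have h1 : IsUnit (1 - (1 - M)) := by
    refine isUnit_one_sub_of_norm_lt_one (lt_of_le_of_lt ?_ one_half_lt_one)
    rwa [norm_sub_rev]
  rw [sub_sub_cancel] at h1
  obtain ⟨u, rfl⟩ := h1
  exact ⟨↑u⁻¹, u.mul_inv, u.inv_mul⟩

theorem det_ne_zero_of_norm_sub_one_le {M : E n →L[ℝ] E n} (hM : ‖M - 1‖ ≤ 1 / 2) :
    M.det ≠ 0 := by
  obtain ⟨N, hN, -⟩ := exists_inverse_of_norm_sub_one_le hM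
  have h1 : M.det * N.det = 1 := by
    have : (M.comp N).det = M.det * N.det := by simp [ContinuousLinearMap.det, LinearMap.det_comp]
    rw [← this, hN]
    simp [ContinuousLinearMap.det]
  exact left_ne_zero_of_mul_eq_one h1

/-- The speed along a characteristic divided by the initial speed. -/
def speedFactor (α : ℝ → ℝ) (χ : E n → ℝ) (w : E n → E n) (t : ℝ) (y : E n) : ℝ :=
  α t * lorentz χ (α t, w y)

/-- The velocity along the characteristic issued from `y`. -/
def velAlong (α : ℝ → ℝ) (χ : E n → ℝ) (w : E n → E n) (t : ℝ) (y : E n) : E n :=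
  speedFactor α χ w t y • w y

/-- The density, up to the initial datum, along the characteristic issued from `y`. -/
def densFactor (α : ℝ → ℝ) (χ : E n → ℝ) (w : E n → E n) (t : ℝ) (y : E n) : ℝ :=
  α t ^ n * (lorentz χ (α t, w y) * (deform α χ w t y).det⁻¹)

namespace IsFlow

variable {c : ℝ}

theorem velAlong_eq (t : ℝ) (y : E n) :
    velAlong α χ w t y = α t • momentum χ (α t, w y) := by
  rw [velAlong, speedFactor, momentum, mul_smul]

/-- This is the velocity system restricted to a characteristic, with the fixed direction `w y`
factored out. -/
theorem hasDerivAt_speedFactor (h : IsFlow c a α A χ w) {t : ℝ} (ht : 0 ≤ t) (y : E n) :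
    HasDerivAt (fun s => speedFactor α χ w s y)
      (-(tderiv a t / a t) * speedFactor α χ w t y *
        (1 - speedFactor α χ w t y ^ 2 * χ (w y))) t := by
  have h1 := h.scale.hasDerivAt t ht
  convert! h1.mul (hasDerivAt_lorentz h.cutoff_nonneg h.cutoff_le h1 (w y)) using 1
  simp only [speedFactor]
  ring

/-- The identity `γ² (1 - χ) + α² γ² χ = 1` has a positive first term because `χ ≤ 1/2`. -/
theorem speedFactor_sq_mul_lt_one (h : IsFlow c a α A χ w) (t : ℝ) (y : E n) :
    speedFactor α χ w t y ^ 2 * χ (w y) < 1 := by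
  have h1 := lorentz_sq h.cutoff_nonneg h.cutoff_le (α t) (w y)
  have h2 := lorentz_pos h.cutoff_nonneg h.cutoff_le (α t, w y)
  have h3 := h.cutoff_le (w y)
  have h4 : 0 < lorentz χ (α t, w y) ^ 2 * (1 - χ (w y)) := by
    have : 0 < 1 - χ (w y) := by linarith
    positivity
  rw [speedFactor]
  nlinarith

theorem norm_velAlong_sq (h : IsFlow c a α A χ w) (t : ℝ) (y : E n) :
    ‖velAlong α χ w t y‖ ^ 2 = c ^ 2 * (speedFactor α χ w t y ^ 2 * χ (w y)) := by
  have := h.light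
  rw [velAlong, norm_smul, mul_pow, Real.norm_eq_abs, sq_abs, h.cutoff_eq]
  field_simp

/-- In the application `L` is the spatial gradient of the velocity, and the hypothesis turns the
evolution of the deformation gradient `M` into `M' = α L M`. -/
theorem hasDerivAt_det_deform (h : IsFlow c a α A χ w) {t : ℝ} (ht : -1 < t) {y : E n}
    {L : E n →L[ℝ] E n}
    (hL : L.comp (deform α χ w t y) = (α t • dsnd (momentum χ) (α t, w y)).comp (fderiv ℝ w y)) :
    HasDerivAt (fun s => (deform α χ w s y).det) (α t * tr L * (deform α χ w t y).det) t := by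
  obtain ⟨N, hN, hN'⟩ := exists_inverse_of_norm_sub_one_le (h.norm_deform_sub_one_le ht y)
  have h1 : HasDerivAt (fun s => deform α χ w s y) ((α t • L).comp (deform α χ w t y)) t := by
    convert! h.hasDerivAt_deform t y using 1
    rw [ContinuousLinearMap.smul_comp, hL, ← ContinuousLinearMap.smul_comp, smul_smul, ← sq]
  convert! hasDerivAt_det_of_linear_ode h1 hN hN' using 2
  simp [tr, Finset.mul_sum]

theorem hasDerivAt_densFactor (h : IsFlow c a α A χ w) {t : ℝ} (ht : 0 ≤ t) {y : E n}
    {L : E n →L[ℝ] E n}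
    (hL : L.comp (deform α χ w t y) = (α t • dsnd (momentum χ) (α t, w y)).comp (fderiv ℝ w y)) :
    HasDerivAt (fun s => densFactor α χ w s y)
      (densFactor α χ w t y * (tderiv a t / a t * (speedFactor α χ w t y ^ 2 * χ (w y) - n)
        - α t * tr L)) t := by
  have ht' : -1 < t := by linarith
  have h1 := h.scale.hasDerivAt t ht
  have h2 := hasDerivAt_lorentz h.cutoff_nonneg h.cutoff_le h1 (w y)
  have hJ := det_ne_zero_of_norm_sub_one_le (h.norm_deform_sub_one_le ht' y)
  convert! (h1.pow n).mul (h2.mul ((h.hasDerivAt_det_deform ht' hL).inv hJ)) using 1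
  -- The case `n = 0` is separate because `n - 1` truncates.
  have hp : (n : ℝ) * α t ^ (n - 1) * α t = n * α t ^ n := by
    rcases n with _ | m
    · simp
    · simp [pow_succ, mul_assoc]
  have hp2 : (n : ℝ) * α t ^ (n - 1) * (-(tderiv a t / a t * α t)) =
      -(tderiv a t / a t) * (n * α t ^ n) := by rw [← hp]; ring
  rw [hp2]
  simp only [densFactor, speedFactor, Pi.pow_apply, Pi.inv_apply, Pi.mul_apply]
  field_simp
  ring

/-- The characteristic flow yields a global classical solution. -/
theorem exists_solution (h : IsFlow c a α A χ w) {ε : ℝ} {ρ₀ : E n → ℝ} (hρ₀ : ContDiff ℝ 1 ρ₀)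
    {v₀ : E n → E n} (hw : ∀ y, w y = ε • v₀ y) (ha : ∀ t, 0 ≤ t → 0 < a t) (ha0 : a 0 = 1) :
    ∃ (ρ : ℝ → E n → ℝ) (v : ℝ → E n → E n) (Y : ℝ → E n → E n),
      IsGlobalClassicalSolution c a ε ρ₀ v₀ ρ v ∧
      (∀ t x, ρ t x = ε * ρ₀ (Y t x) * densFactor α χ w t (Y t x)) ∧
      ∀ t, 0 ≤ t → ∀ x x', ‖Y t x - Y t x'‖ ≤ 2 * ‖x - x'‖ := by
  obtain ⟨Y, hY⟩ := exists_contDiffAt_inverse isOpen_Ioi h.contDiff_disp h.lipschitz_disp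
  have hmem : ∀ {t : ℝ}, 0 ≤ t → t ∈ Ioi (-1 : ℝ) := fun ht => mem_Ioi.2 (by linarith)
  set v : ℝ → E n → E n := fun t x => velAlong α χ w t (Y t x) with hv
  set ρ : ℝ → E n → ℝ := fun t x => ε * ρ₀ (Y t x) * densFactor α χ w t (Y t x) with hρ
  have hα := h.scale.contDiff
  have hα0 : α 0 = 1 := by rw [h.scale.eq_inv 0 le_rfl, ha0, inv_one]
  have hwC : ContDiff ℝ 1 w := h.contDiff_init.of_le one_le_two
  have hαfst : ContDiff ℝ 1 fun p : ℝ × E n => α p.1 := hα.comp contDiff_fst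
  have hlor : ContDiff ℝ 1 fun p : ℝ × E n => lorentz χ (α p.1, w p.2) :=
    ((contDiff_lorentz h.smooth_cutoff h.cutoff_nonneg h.cutoff_le).of_le (by simp)).comp
      (hαfst.prodMk (hwC.comp contDiff_snd))
  have hvelC : ContDiff ℝ 1 fun p : ℝ × E n => velAlong α χ w p.1 p.2 :=
    (hαfst.mul hlor).smul (hwC.comp contDiff_snd)
  have hYC : ∀ {t}, 0 ≤ t → ∀ x, ContDiffAt ℝ 1 (fun p : ℝ × E n => (p.1, Y p.1 p.2)) (t, x) :=
    fun ht x => contDiffAt_fst.prodMk ((hY _ (hmem ht)).2.2.2 x)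
  have hvC : ∀ {t}, 0 ≤ t → ∀ x, ContDiffAt ℝ 1 (fun p : ℝ × E n => v p.1 p.2) (t, x) :=
    fun ht x => hvelC.contDiffAt.comp _ (hYC ht x)
  have hρC : ∀ {t}, 0 ≤ t → ∀ x, ContDiffAt ℝ 1 (fun p : ℝ × E n => ρ p.1 p.2) (t, x) := by
    intro t ht x
    have h1 : ContDiffAt ℝ 1 (fun p : ℝ × E n => ε * ρ₀ p.2 * densFactor α χ w p.1 p.2)
        (t, Y t x) := by
      refine (contDiff_const.mul (hρ₀.comp contDiff_snd)).contDiffAt.mul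
        ((hαfst.pow n).contDiffAt.mul (hlor.contDiffAt.mul (ContDiffAt.inv ?_ ?_)))
      · exact (contDiff_det.comp h.contDiff_deform).contDiffAt
      · exact det_ne_zero_of_norm_sub_one_le (h.norm_deform_sub_one_le (hmem ht) _)
    exact h1.comp (t, x) (hYC ht x)
  have hcurve : ∀ {t}, 0 ≤ t → ∀ y, ∀ᶠ s in 𝓝 t, Y s (y + disp α χ w s y) = y := fun ht y => by
    filter_upwards [isOpen_Ioi.mem_nhds (hmem ht)] with s hs using (hY s hs).2.1 y
  have hspeed : ∀ t x, speedSq v t x = ‖v t x‖ ^ 2 := fun t x => by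
    rw [EuclideanSpace.norm_sq_eq]
    simp [speedSq]
  have hspeed' : ∀ t x, speedSq v t x =
      c ^ 2 * (speedFactor α χ w t (Y t x) ^ 2 * χ (w (Y t x))) := fun t x => by
    rw [hspeed, hv, h.norm_velAlong_sq]
  have hc2 : 0 < c ^ 2 := pow_pos h.light 2
  have hsub : ∀ t x, speedSq v t x < c ^ 2 := fun t x => by
    rw [hspeed']
    exact mul_lt_of_lt_one_right hc2 (h.speedFactor_sq_mul_lt_one t _)
  have hcompD : ∀ {t}, 0 ≤ t → ∀ x i,
      DifferentiableAt ℝ (fun p : ℝ × E n => comp v i p.1 p.2) (t, x) := fun ht x i =>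
    ((EuclideanSpace.proj i : E n →L[ℝ] ℝ).contDiff.contDiffAt.comp _
      (hvC ht x)).differentiableAt one_ne_zero
  have hX : ∀ {t}, 0 ≤ t → ∀ x, HasDerivAt (fun s => Y t x + disp α χ w s (Y t x))
      ((a t)⁻¹ • v t x) t := by
    intro t ht x
    convert! h.hasDerivAt_position t (Y t x) using 1
    simp only [hv]
    rw [← h.scale.eq_inv t ht, velAlong_eq, smul_smul, sq]
  -- Transport terms in the equations are derivatives along characteristics, so each equation
  -- reduces to an ODE already solved.
  have hmat : ∀ {t} (ht : 0 ≤ t) (x) {f : ℝ → E n → ℝ} {d : ℝ},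
      DifferentiableAt ℝ (fun p : ℝ × E n => f p.1 p.2) (t, x) →
      HasDerivAt (fun s => f s (Y t x + disp α χ w s (Y t x))) d t →
      pt f t x + ∑ j, comp v j t x / a t * px j f t x = d := by
    intro t ht x f d hf hd
    have h1 := hasDerivAt_along ht hf (hX ht x) ((hY t (hmem ht)).1 x)
    rw [← h1.unique hd]
    congr 1
    refine Finset.sum_congr rfl fun j _ => ?_
    simp [comp, div_eq_inv_mul]
  refine ⟨ρ, v, Y, ⟨?_, ?_, ?_, ?_, ?_, ?_, ?_⟩, fun _ _ => rfl,
    fun t ht => (hY t (hmem ht)).2.2.1⟩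
  · exact fun p hp => (hρC hp.1 p.2).contDiffWithinAt
  · exact fun p hp => (hvC hp.1 p.2).contDiffWithinAt
  · intro t _ x
    have := hsub t x
    rw [hspeed] at this
    exact lt_of_pow_lt_pow_left₀ 2 h.light.le this
  · intro t ht x
    have hat := ha t ht
    set y := Y t x with hy
    -- Differentiate `v(t, X(t, z)) = α momentum(α, w z)` in `z`, in two ways.
    have hL : (fderiv ℝ (v t) x).comp (deform α χ w t y) =
        (α t • dsnd (momentum χ) (α t, w y)).comp (fderiv ℝ w y) := by
      have hvd : DifferentiableAt ℝ (v t) x :=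
        ((hvC ht x).differentiableAt one_ne_zero).comp x
          (hasFDerivAt_prodMk_right t x).differentiableAt
      have hvd' : HasFDerivAt (v t) (fderiv ℝ (v t) x) (y + disp α χ w t y) := by
        rw [(hY t (hmem ht)).1 x]
        exact hvd.hasFDerivAt
      have h1 : HasFDerivAt (fun z => v t (z + disp α χ w t z))
          ((fderiv ℝ (v t) x).comp (deform α χ w t y)) y :=
        HasFDerivAt.comp (f := fun z => z + disp α χ w t z) (g := v t) y hvd'
          (h.hasFDerivAt_position t y)
      have h2 : HasFDerivAt (fun z => α t • momentum χ (α t, w z))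
          ((α t • dsnd (momentum χ) (α t, w y)).comp (fderiv ℝ w y)) y :=
        ((hasFDerivAt_dsnd h.smooth_momentum (α t) (w y)).const_smul (α t)).comp y
          (h.hasFDerivAt_init y)
      refine h1.unique (h2.congr_of_eventuallyEq (Eventually.of_forall fun z => ?_))
      simp only [hv]
      rw [(hY t (hmem ht)).2.1 z, velAlong_eq]
    have hdiv : ∑ i, px i (comp v i) t x = tr (fderiv ℝ (v t) x) := by
      refine Finset.sum_congr rfl fun i _ => ?_
      have hvd : DifferentiableAt ℝ (v t) x :=
        ((hvC ht x).differentiableAt one_ne_zero).comp x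
          (hasFDerivAt_prodMk_right t x).differentiableAt
      have h1 : HasFDerivAt (comp v i t) ((EuclideanSpace.proj i : E n →L[ℝ] ℝ).comp
          (fderiv ℝ (v t) x)) x :=
        (EuclideanSpace.proj i : E n →L[ℝ] ℝ).hasFDerivAt.comp x hvd.hasFDerivAt
      rw [px, h1.fderiv]
      rfl
    have hDρ := hmat ht x ((hρC ht x).differentiableAt one_ne_zero)
      (((h.hasDerivAt_densFactor ht hL).const_mul (ε * ρ₀ y)).congr_of_eventuallyEq
        (by filter_upwards [hcurve ht y] with s hs; simp only [hρ]; rw [hs]))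
    have hspD : DifferentiableAt ℝ (fun p : ℝ × E n => speedSq v p.1 p.2) (t, x) := by
      simp only [speedSq]
      exact DifferentiableAt.fun_sum fun i _ => (hcompD ht x i).pow 2
    have hDu := hmat ht x hspD
      (((((h.hasDerivAt_speedFactor ht y).pow 2).mul_const (χ (w y))).const_mul
        (c ^ 2)).congr_of_eventuallyEq
        (by filter_upwards [hcurve ht y] with s hs; rw [hspeed', hs]; rfl))
    have hu := hspeed' t x
    have hul := hsub t x
    rw [DensityEq]
    have hsplit : ∑ i, (px i (comp v i) t x * (1 / a t)
        + px i (speedSq v) t x * (comp v i t x / (a t * (c ^ 2 - speedSq v t x)))) =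
        tr (fderiv ℝ (v t) x) / a t
          + (∑ i, comp v i t x / a t * px i (speedSq v) t x) / (c ^ 2 - speedSq v t x) := by
      rw [Finset.sum_add_distrib, ← Finset.sum_mul, hdiv, Finset.sum_div]
      congr 1
      · ring
      · refine Finset.sum_congr rfl fun i _ => ?_
        field_simp
    have hρx : ρ t x = ε * ρ₀ y * densFactor α χ w t y := rfl
    rw [hsplit, hDρ, hρx]
    rw [← hy] at hu
    have hne : c ^ 2 - speedSq v t x ≠ 0 := by linarith
    -- The two terms with `u` form its material derivative over `c² - u`; since `Du = -2 (a'/a) u (1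
    -- - u/c²)`, the singular denominator cancels.
    have hpt : pt (speedSq v) t x / (c ^ 2 - speedSq v t x) +
        (∑ i, comp v i t x / a t * px i (speedSq v) t x) / (c ^ 2 - speedSq v t x) =
        -2 * (tderiv a t / a t) * (speedFactor α χ w t y ^ 2 * χ (w y)) := by
      rw [← add_div, hDu, div_eq_iff hne, hu]
      norm_num
      ring
    have hu' : speedSq v t x / c ^ 2 = speedFactor α χ w t y ^ 2 * χ (w y) := by
      rw [hu, mul_div_cancel_left₀ _ hc2.ne']
    rw [hu', h.scale.eq_inv t ht]
    linear_combination (ε * ρ₀ y * densFactor α χ w t y) * hpt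
  · intro t ht x i
    set y := Y t x with hy
    have hDv := hmat ht x (hcompD ht x i)
      (((h.hasDerivAt_speedFactor ht y).mul_const (w y i)).congr_of_eventuallyEq
        (by filter_upwards [hcurve ht y] with s hs; simp only [comp, hv]; rw [hs]; simp [velAlong]))
    have hu' : speedSq v t x / c ^ 2 = speedFactor α χ w t y ^ 2 * χ (w y) := by
      rw [hspeed' t x, mul_div_cancel_left₀ _ hc2.ne']
    have hcv : comp v i t x = speedFactor α χ w t y * w y i := by
      simp [comp, hv, velAlong, hy]
    rw [hDv, hu', hcv]
    ring
  · intro x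
    have hY0 : Y 0 x = x := by simpa [disp_zero] using (hY 0 (hmem le_rfl)).1 x
    simp [hρ, hY0, densFactor, hα0, lorentz_one, deform_zero, ContinuousLinearMap.det]
  · intro x
    have hY0 : Y 0 x = x := by simpa [disp_zero] using (hY 0 (hmem le_rfl)).1 x
    simp [hv, hY0, velAlong, speedFactor, hα0, lorentz_one, hw]

end IsFlow

end Flow

/-! ### Calculus of bounded Lipschitz functions -/

section BddLip

variable {V F G W : Type*} [NormedAddCommGroup V] [NormedAddCommGroup F] [NormedAddCommGroup G]
  [NormedAddCommGroup W]

/-- `f` is bounded by `K` and `K`-Lipschitz. -/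
def BddLip (K : ℝ) (f : V → F) : Prop :=
  (∀ x, ‖f x‖ ≤ K) ∧ ∀ x y, ‖f x - f y‖ ≤ K * ‖x - y‖

theorem BddLip.bilinear {B : F → G → W} (hB : ∀ u v, ‖B u v‖ ≤ ‖u‖ * ‖v‖)
    (hsub : ∀ u u' v v', B u v - B u' v' = B (u - u') v + B u' (v - v'))
    {K L : ℝ} (hK : 0 ≤ K) (hL : 0 ≤ L) {f : V → F} {g : V → G} (hf : BddLip K f)
    (hg : BddLip L g) : BddLip (2 * K * L) fun x => B (f x) (g x) := by
  refine ⟨fun x => ?_, fun x y => ?_⟩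
  · calc ‖B (f x) (g x)‖ ≤ ‖f x‖ * ‖g x‖ := hB _ _
      _ ≤ K * L := mul_le_mul (hf.1 x) (hg.1 x) (norm_nonneg _) hK
      _ ≤ 2 * K * L := by nlinarith [mul_nonneg hK hL]
  · rw [hsub]
    calc ‖B (f x - f y) (g x) + B (f y) (g x - g y)‖
        ≤ ‖f x - f y‖ * ‖g x‖ + ‖f y‖ * ‖g x - g y‖ :=
          (norm_add_le _ _).trans (add_le_add (hB _ _) (hB _ _))
      _ ≤ (K * ‖x - y‖) * L + K * (L * ‖x - y‖) := by
          gcongr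
          · exact hf.2 x y
          · exact hg.1 x
          · exact hf.1 y
          · exact hg.2 x y
      _ = 2 * K * L * ‖x - y‖ := by ring

theorem BddLip.mul {K L : ℝ} (hK : 0 ≤ K) (hL : 0 ≤ L) {f g : V → ℝ} (hf : BddLip K f)
    (hg : BddLip L g) : BddLip (2 * K * L) fun x => f x * g x :=
  BddLip.bilinear (B := fun u v => u * v) (fun u v => norm_mul_le u v)
    (fun u u' v v' => by ring) hK hL hf hg

theorem BddLip.const_mul {K : ℝ} (k : ℝ) {f : V → ℝ} (hf : BddLip K f) :
    BddLip (|k| * K) fun x => k * f x := by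
  refine ⟨fun x => ?_, fun x y => ?_⟩
  · rw [norm_mul, Real.norm_eq_abs]
    gcongr
    exact hf.1 x
  · rw [← mul_sub, norm_mul, Real.norm_eq_abs, mul_assoc]
    gcongr
    exact hf.2 x y

theorem BddLip.const_smul [NormedSpace ℝ F] {K k : ℝ} (hk : |k| ≤ 1) {f : V → F}
    (hf : BddLip K f) : BddLip K fun x => k • f x := by
  refine ⟨fun x => ?_, fun x y => ?_⟩
  · rw [norm_smul]
    exact (mul_le_of_le_one_left (norm_nonneg _) hk).trans (hf.1 x)
  · rw [← smul_sub, norm_smul]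
    exact (mul_le_of_le_one_left (norm_nonneg _) hk).trans (hf.2 x y)

/-- The constant `B * (1 + L)` dominates both the bound `B` and the Lipschitz constant `B * L`. -/
theorem BddLip.comp_of_mem {S : Set F} {φ : F → G} {B L : ℝ} {f : V → F} (hB : 0 ≤ B) (hL : 0 ≤ L)
    (hφ : ∀ u ∈ S, ‖φ u‖ ≤ B ∧ ∀ v ∈ S, ‖φ u - φ v‖ ≤ B * ‖u - v‖) (hS : ∀ x, f x ∈ S)
    (hf : ∀ x y, ‖f x - f y‖ ≤ L * ‖x - y‖) : BddLip (B * (1 + L)) fun x => φ (f x) := by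
  refine ⟨fun x => ((hφ _ (hS x)).1).trans (by nlinarith [mul_nonneg hB hL]), fun x y => ?_⟩
  calc ‖φ (f x) - φ (f y)‖ ≤ B * ‖f x - f y‖ := (hφ _ (hS x)).2 _ (hS y)
    _ ≤ B * (L * ‖x - y‖) := by gcongr; exact hf x y
    _ ≤ B * (1 + L) * ‖x - y‖ := by nlinarith [mul_nonneg hB (norm_nonneg (x - y))]

end BddLip

/-! ### Lipschitz bounds from bounded derivatives -/

section CkNorm

variable {n : ℕ} {F : Type*} [NormedAddCommGroup F] [NormedSpace ℝ F]

theorem lipschitz_of_norm_fderiv_le {f : E n → F} {K : ℝ} (hf : Differentiable ℝ f)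
    (hK : ∀ x, ‖fderiv ℝ f x‖ ≤ K) (x y : E n) : ‖f x - f y‖ ≤ K * ‖x - y‖ :=
  convex_univ.norm_image_sub_le_of_norm_fderiv_le (fun z _ => hf z) (fun z _ => hK z)
    (mem_univ y) (mem_univ x)

theorem HasBoundedCkNorm.exists_bddLip {f : E n → F} (hf : HasBoundedCkNorm 1 f) :
    ∃ K, 0 ≤ K ∧ BddLip K f := by
  obtain ⟨hC, K, hK⟩ := hf
  have h0 : ∀ x, ‖f x‖ ≤ K := fun x => by simpa using hK 0 zero_le_one x
  have h1 : ∀ x, ‖fderiv ℝ f x‖ ≤ K := fun x => by simpa using hK 1 le_rfl x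
  exact ⟨K, (norm_nonneg _).trans (h0 0), h0,
    lipschitz_of_norm_fderiv_le (hC.differentiable one_ne_zero) h1⟩

theorem HasBoundedCkNorm.exists_bddLip_fderiv {f : E n → F} (hf : HasBoundedCkNorm 2 f) :
    ∃ K, 0 ≤ K ∧ BddLip K f ∧ BddLip K (fderiv ℝ f) := by
  obtain ⟨hC, K, hK⟩ := hf
  have h0 : ∀ x, ‖f x‖ ≤ K := fun x => by simpa using hK 0 zero_le_two x
  have h1 : ∀ x, ‖fderiv ℝ f x‖ ≤ K := fun x => by simpa using hK 1 one_le_two x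
  have h2 : ∀ x, ‖fderiv ℝ (fderiv ℝ f) x‖ ≤ K := fun x => by
    have := hK 2 le_rfl x
    rwa [← norm_iteratedFDeriv_fderiv, norm_iteratedFDeriv_one] at this
  refine ⟨K, (norm_nonneg _).trans (h0 0),
    ⟨h0, lipschitz_of_norm_fderiv_le (hC.differentiable two_ne_zero) h1⟩,
    ⟨h1, lipschitz_of_norm_fderiv_le ?_ h2⟩⟩
  exact (hC.fderiv_right (m := 1) (by norm_num)).differentiable one_ne_zero

end CkNorm

/-! ### Uniform estimates and smallness of the data -/

section Bounds

variable {n : ℕ}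

/-- The determinant has no zero on this compact convex ball, so its inverse is `C¹` there. -/
theorem exists_bound_inv_det (n : ℕ) : ∃ B : ℝ, 0 ≤ B ∧
    ∀ M ∈ Metric.closedBall (1 : E n →L[ℝ] E n) (1 / 2), ‖M.det⁻¹‖ ≤ B ∧
      ∀ N ∈ Metric.closedBall (1 : E n →L[ℝ] E n) (1 / 2),
        ‖M.det⁻¹ - N.det⁻¹‖ ≤ B * ‖M - N‖ := by
  have hC : ContDiffOn ℝ 1 (fun M : E n →L[ℝ] E n => M.det⁻¹)
      (Metric.closedBall (1 : E n →L[ℝ] E n) (1 / 2)) :=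
    contDiff_det.contDiffOn.inv fun M hM =>
      det_ne_zero_of_norm_sub_one_le (mem_closedBall_iff_norm.1 hM)
  have : ProperSpace (E n →L[ℝ] E n) := FiniteDimensional.proper ℝ _
  have hK := isCompact_closedBall (1 : E n →L[ℝ] E n) (1 / 2)
  obtain ⟨B, hB⟩ := hK.exists_bound_of_continuousOn hC.continuousOn
  obtain ⟨L, hL⟩ := hC.exists_lipschitzOnWith one_ne_zero (convex_closedBall _ _) hK
  refine ⟨max B L, le_max_of_le_right L.2, fun M hM => ⟨(hB M hM).trans (le_max_left _ _),
    fun N hN => (hL.norm_sub_le hM hN).trans ?_⟩⟩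
  gcongr
  exact le_max_right _ _

/-- Every factor is a bounded Lipschitz function of `w` or `fderiv ℝ w`, with constants controlled
by `K` and the integral of `α²`. The constant `D` precedes `w` and `t`, hence is uniform in `ε` and
in time. -/
theorem exists_bddLip_densFactor {c : ℝ} {a α : ℝ → ℝ} {A : ℝ} {χ : E n → ℝ}
    (hχ : ContDiff ℝ ∞ χ) (h0 : ∀ z, 0 ≤ χ z) (h1 : ∀ z, χ z ≤ 1 / 2) {K : ℝ} (hK : 0 ≤ K) :
    ∃ D, 0 ≤ D ∧ ∀ w : E n → E n, IsFlow c a α A χ w → BddLip K w → BddLip K (fderiv ℝ w) →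
      ∀ t, 0 ≤ t → BddLip (α t ^ n * D) (densFactor α χ w t) := by
  obtain ⟨B₁, hB₁, hlor⟩ := exists_bound_lipschitz_on_ball (contDiff_lorentz hχ h0 h1) K
  obtain ⟨B₂, hB₂, hmom⟩ := exists_bound_lipschitz_on_ball
    (contDiff_dsnd (contDiff_momentum hχ h0 h1)) K
  obtain ⟨B₃, hB₃, hdet⟩ := exists_bound_inv_det n
  set L := 2 * (|A| * B₂ * (1 + K)) * K with hL
  refine ⟨2 * (B₁ * (1 + K)) * (B₃ * (1 + L)), by positivity, fun w h hw hw' t ht => ?_⟩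
  have hα := h.scale.mem_Icc
  have ht' : -1 < t := by linarith
  have hA : |∫ s in (0 : ℝ)..t, α s ^ 2| ≤ |A| := (h.scale.integral_sq_le t ht').trans (le_abs_self A)
  have hwB : ∀ y, w y ∈ Metric.closedBall (0 : E n) K := fun y => by
    simpa using hw.1 y
  have hlor' : BddLip (B₁ * (1 + K)) fun y => lorentz χ (α t, w y) :=
    BddLip.comp_of_mem (φ := fun z => lorentz χ (α t, z)) hB₁ hK (hlor (α t) (hα t)) hwB hw.2
  have hP : BddLip (|A| * B₂ * (1 + K)) fun y => wprim α (dsnd (momentum χ)) t (w y) :=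
    BddLip.comp_of_mem (φ := wprim α (dsnd (momentum χ)) t) (by positivity) hK
      (fun u hu => ⟨norm_wprim_le h.scale.contDiff.continuous hA hB₂
        fun s => (hmom _ (hα s) u hu).1, fun v hv =>
          norm_wprim_sub_le h.scale.contDiff.continuous (contDiff_dsnd h.smooth_momentum) hA hB₂
            fun s => (hmom _ (hα s) u hu).2 v hv⟩) hwB hw.2
  have hM : BddLip L fun y => (wprim α (dsnd (momentum χ)) t (w y)).comp (fderiv ℝ w y) :=
    BddLip.bilinear (B := fun P Q : E n →L[ℝ] E n => P.comp Q)
      (fun P Q => ContinuousLinearMap.opNorm_comp_le P Q)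
      (fun P P' Q Q' => by
        rw [ContinuousLinearMap.sub_comp, ContinuousLinearMap.comp_sub]; abel)
      (by positivity) hK hP hw'
  have hdet' : BddLip (B₃ * (1 + L)) fun y => (deform α χ w t y).det⁻¹ :=
    BddLip.comp_of_mem (φ := fun M : E n →L[ℝ] E n => M.det⁻¹) hB₃ (by positivity) hdet
      (fun y => mem_closedBall_iff_norm.2 (h.norm_deform_sub_one_le ht' y))
      (fun y z => by simpa only [deform, add_sub_add_left_eq_sub] using hM.2 y z)
  have := (BddLip.mul (by positivity) (by positivity) hlor' hdet').const_mul (α t ^ n)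
  rwa [abs_of_nonneg (pow_nonneg (hα t).1 n)] at this

/-- For small `ε`, the initial velocity `ε v₀` generates a characteristic flow. -/
theorem exists_isFlow {c : ℝ} (hc : 0 < c) {a α : ℝ → ℝ} {A : ℝ} (hα : InverseScale a α A)
    {χ : E n → ℝ} (hχ : ContDiff ℝ ∞ χ) (h0 : ∀ z, 0 ≤ χ z) (h1 : ∀ z, χ z ≤ 1 / 2)
    (hχe : ∀ z, ‖z‖ ≤ c / 4 → χ z = ‖z‖ ^ 2 / c ^ 2) {v₀ : E n → E n} (hv₀ : ContDiff ℝ 2 v₀)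
    {K : ℝ} (hK : 0 ≤ K) (hv : BddLip K v₀) :
    ∃ ε₀ : ℝ, 0 < ε₀ ∧ ε₀ ≤ 1 ∧ ∀ ε : ℝ, 0 ≤ ε → ε ≤ ε₀ → IsFlow c a α A χ fun y => ε • v₀ y := by
  obtain ⟨B, hB, hmom⟩ := exists_bound_lipschitz_on_ball (contDiff_momentum hχ h0 h1) (c / 4)
  have hA : 0 ≤ A := (abs_nonneg _).trans (hα.integral_sq_le 0 (by norm_num))
  have hden : 1 ≤ 1 + 4 * K / c + 2 * A * B * K := by
    have : 0 ≤ 4 * K / c + 2 * A * B * K := by positivity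
    linarith
  -- The three summands ensure `ε₀ ≤ 1`, initial speeds at most `c/4` where the cut-off is exact,
  -- and a displacement with Lipschitz constant at most 1/2.
  refine ⟨(1 + 4 * K / c + 2 * A * B * K)⁻¹, by positivity, inv_le_one_of_one_le₀ hden,
    fun ε hε hεle => ?_⟩
  have hε1 : ε * (1 + 4 * K / c + 2 * A * B * K) ≤ 1 := by
    calc _ ≤ (1 + 4 * K / c + 2 * A * B * K)⁻¹ * (1 + 4 * K / c + 2 * A * B * K) := by gcongr
      _ = 1 := inv_mul_cancel₀ (by positivity)
  have h4 : ε * (4 * K / c) ≤ 1 := by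
    have : 0 ≤ ε * (2 * A * B * K) := by positivity
    nlinarith
  have h2 : A * B * (ε * K) ≤ 1 / 2 := by
    have : 0 ≤ ε * (4 * K / c) := by positivity
    nlinarith
  have hsmall : ∀ y, ‖ε • v₀ y‖ ≤ c / 4 := fun y => by
    rw [norm_smul, Real.norm_eq_abs, abs_of_nonneg hε]
    have h5 : ε * K ≤ c / 4 := by
      rw [mul_div_assoc', div_le_one hc] at h4
      linarith
    exact (mul_le_mul_of_nonneg_left (hv.1 y) hε).trans h5
  refine ⟨hc, hα, hχ, h0, h1, fun y => hχe _ (hsmall y), hv₀.const_smul ε,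
    fun t ht y z => ?_⟩
  have h6 := norm_wprim_sub_le hα.contDiff.continuous (contDiff_momentum hχ h0 h1)
    (w := ε • v₀ y) (z := ε • v₀ z) (hα.integral_sq_le t ht) hB fun s =>
      (hmom _ (hα.mem_Icc s) _ (mem_closedBall_zero_iff.2 (hsmall y))).2 _
        (mem_closedBall_zero_iff.2 (hsmall z))
  refine h6.trans ?_
  rw [← smul_sub, norm_smul, Real.norm_eq_abs, abs_of_nonneg hε]
  calc A * B * (ε * ‖v₀ y - v₀ z‖) ≤ A * B * (ε * (K * ‖y - z‖)) := by
        gcongr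
        exact hv.2 y z
    _ = A * B * (ε * K) * ‖y - z‖ := by ring
    _ ≤ 1 / 2 * ‖y - z‖ := by gcongr

theorem tendstoUniformly_zero_of_norm_le {V F : Type*} [NormedAddCommGroup F] {f : ℝ → V → F}
    {g : ℝ → ℝ} (hg : Tendsto g atTop (𝓝 0)) (hf : ∀ t, 0 ≤ t → ∀ x, ‖f t x‖ ≤ g t) :
    TendstoUniformly f (fun _ => 0) atTop := by
  rw [Metric.tendstoUniformly_iff]
  intro ε hε
  filter_upwards [hg.eventually_lt_const hε, eventually_ge_atTop 0] with t ht ht0 x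
  rw [dist_zero_left]
  exact (hf t ht0 x).trans_lt ht

end Bounds

end RelDust

end

/-! ### Decay of the density and of its gradient -/

theorem theorem3 (n : ℕ) (hn : 1 ≤ n) (c : ℝ) (hc : 0 < c)
    (a : ℝ → ℝ) (ha : RelDust.IsScaleFactor a)
    (hH : RelDust.AssumptionH1 a ∨ RelDust.AssumptionH2 a)
    (ρ₀ : RelDust.E n → ℝ) (hρ₀ : RelDust.HasBoundedCkNorm 1 ρ₀)
    (v₀ : RelDust.E n → RelDust.E n) (hv₀ : RelDust.HasBoundedCkNorm 2 v₀) :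
    ∃ ε₀ : ℝ, 0 < ε₀ ∧ ∃ C : ℝ, 0 < C ∧ ∀ ε : ℝ, 0 ≤ ε → ε ≤ ε₀ →
      ∃ (ρ : ℝ → RelDust.E n → ℝ) (v : ℝ → RelDust.E n → RelDust.E n),
        RelDust.IsGlobalClassicalSolution c a ε ρ₀ v₀ ρ v ∧
        (∃ K : ℝ, ∀ t : ℝ, 0 ≤ t → ∀ x, |ρ t x| ≤ K ∧ ‖gradient (ρ t) x‖ ≤ K) ∧
        (∀ t : ℝ, 0 ≤ t → ∀ x, |ρ t x| ≤ C * ε * (a t ^ n)⁻¹) ∧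
        TendstoUniformly ρ (fun _ => 0) atTop ∧
        TendstoUniformly (fun t x => gradient (ρ t) x) (fun _ => 0) atTop := by
  open RelDust in
  obtain ⟨α, A, hα⟩ := exists_inverseScale ha hH
  obtain ⟨χ, hχ, h0, h1, hχe⟩ := exists_cutoff_normSq n hc
  obtain ⟨R, hR, hρR⟩ := hρ₀.exists_bddLip
  obtain ⟨K, hK, hvK, hvK'⟩ := hv₀.exists_bddLip_fderiv
  obtain ⟨ε₀, hε₀, hε₀1, hflow⟩ := exists_isFlow hc hα hχ h0 h1 hχe hv₀.1 hK hvK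
  obtain ⟨D, hD, hdens⟩ := exists_bddLip_densFactor (c := c) (a := a) (α := α) (A := A) hχ h0 h1 hK
  -- The decay constant is `2 * R * D`; the added 1 only secures positivity.
  refine ⟨ε₀, hε₀, 2 * R * D + 1, by positivity, fun ε hε hεle => ?_⟩
  have hw := hflow ε hε hεle
  have hε1 : |ε| ≤ 1 := by rw [abs_of_nonneg hε]; exact hεle.trans hε₀1
  have hwK' : BddLip K (fderiv ℝ fun y => ε • v₀ y) := by
    convert! hvK'.const_smul hε1 using 1
    funext y
    exact fderiv_fun_const_smul (hv₀.1.differentiable two_ne_zero y) ε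
  obtain ⟨ρ, v, Y, hsol, hρ, hY⟩ := hw.exists_solution hρ₀.1 (fun y => rfl) ha.pos ha.init
  have hB : ∀ t, 0 ≤ t → BddLip (2 * (ε * R) * (α t ^ n * D))
      fun y => ε * ρ₀ y * densFactor α χ (fun y => ε • v₀ y) t y := fun t ht => by
    have h2 := hρR.const_mul ε
    rw [abs_of_nonneg hε] at h2
    exact BddLip.mul (by positivity)
      (mul_nonneg (pow_nonneg (hα.mem_Icc t).1 n) hD) h2 (hdens _ hw (hvK.const_smul hε1) hwK' t ht)
  have hρb : ∀ t, 0 ≤ t → ∀ x, |ρ t x| ≤ 2 * (ε * R) * (α t ^ n * D) := fun t ht x => by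
    rw [hρ, ← Real.norm_eq_abs]
    exact (hB t ht).1 (Y t x)
  have hgb : ∀ t, 0 ≤ t → ∀ x, ‖gradient (ρ t) x‖ ≤ 2 * (2 * (ε * R) * (α t ^ n * D)) := by
    intro t ht x
    have hnn : 0 ≤ 2 * (ε * R) * (α t ^ n * D) := (abs_nonneg _).trans (hρb t ht x)
    rw [gradient, LinearIsometryEquiv.norm_map]
    -- The gradient is bounded by the Lipschitz constant of the density in the label `y`, times the
    -- factor 2 from `Y`.
    refine norm_fderiv_le_of_lip' ℝ (by positivity) (Eventually.of_forall fun z => ?_)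
    rw [hρ, hρ]
    refine ((hB t ht).2 (Y t z) (Y t x)).trans ?_
    calc 2 * (ε * R) * (α t ^ n * D) * ‖Y t z - Y t x‖
        ≤ 2 * (ε * R) * (α t ^ n * D) * (2 * ‖z - x‖) := by
          gcongr
          exact hY t ht z x
      _ = _ := by ring
  -- With `n ≥ 1` and `α ≤ 1`, decay of `α` alone suffices for the limits.
  have hpow : ∀ t, 0 ≤ t → 2 * (ε * R) * (α t ^ n * D) ≤ 2 * (ε * R) * (α t * D) := fun t ht => by
    have : α t ^ n ≤ α t := pow_le_of_le_one (hα.pos t ht).le (hα.le_one t ht) (by omega)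
    gcongr
  have hle : ∀ t, 0 ≤ t → 2 * (ε * R) * (α t * D) ≤ 2 * (ε * R) * D := fun t ht => by
    have := mul_le_of_le_one_left hD (hα.le_one t ht)
    gcongr
  have hlim : Tendsto (fun t => 2 * (ε * R) * (α t * D)) atTop (nhds 0) := by
    simpa using (hα.tendsto_zero.mul_const D).const_mul (2 * (ε * R))
  refine ⟨ρ, v, hsol, ⟨2 * (2 * (ε * R) * D), fun t ht x => ⟨?_, ?_⟩⟩, fun t ht x => ?_, ?_, ?_⟩
  · have : 0 ≤ 2 * (ε * R) * D := by positivity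
    linarith [hρb t ht x, hpow t ht, hle t ht]
  · linarith [hgb t ht x, hpow t ht, hle t ht]
  · refine (hρb t ht x).trans ?_
    rw [← inv_pow, ← hα.eq_inv t ht]
    have : 0 ≤ ε * α t ^ n := mul_nonneg hε (pow_nonneg (hα.mem_Icc t).1 n)
    nlinarith
  · exact tendstoUniformly_zero_of_norm_le hlim fun t ht x => (hρb t ht x).trans (hpow t ht)
  · refine tendstoUniformly_zero_of_norm_le (g := fun t => 2 * (2 * (ε * R) * (α t * D)))
      (by simpa using hlim.const_mul 2) fun t ht x => (hgb t ht x).trans ?_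
    have := hpow t ht
    linarith
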